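/- Let $d\ge 1$ be an integer and $q\in\mathbb C\setminus\{0\}$. For $n\ge 0$ let $\mathcal F_n$ be the framed braid group, generated by $\sigma_1,\dots,\sigma_{n-1},t_1,\dots,t_n$ subject to $\sigma_i\sigma_j\sigma_i=\sigma_j\sigma_i\sigma_j$ for $|i-j|=1$, $\sigma_i\sigma_j=\sigma_j\sigma_i$ for $|i-j|>1$, $t_it_j=t_jt_i$ and $t_j\sigma_i=\sigma_it_{s_i(j)}$, where $s_i$ is the transposition $(i,i+1)$. Let $\mathcal F_{d,n}$ be the quotient of $\mathcal F_n$ by the relations $t_j^d=1$, and let $\mathrm Y_{d,n}(q)$ be the Yokonuma–Hecke algebra, i.e. the quotient of the group algebra $\mathbb C\mathcal F_{d,n}$ by the two-sided ideal generated by the elements $\sigma_i^2-1-(q-q^{-1})e_i\sigma_i$ $(1\le i\le n-1)$, where $e_i=\frac1d\sum_{s=1}^{d}t_i^st_{i+1}^{-s}$. Write $g_i$ for the image of $\sigma_i$. There is a unique linear map $$\mathrm{tr}_d:\bigcup_{n\ge 0}\mathrm Y_{d,n}(q)\to\mathbb C[z,x_1,\dots,x_{d-1}]$$ (that is, a unique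 family of $\mathbb C$-linear maps on the $\mathrm Y_{d,n}(q)$, compatible with the natural inclusions $\mathrm Y_{d,n}(q)\to\mathrm Y_{d,n+1}(q)$) such that, for all $n$, (1) $\mathrm{tr}_d(ab)=\mathrm{tr}_d(ba)$ for $a,b\in\mathrm Y_{d,n}(q)$; (2) $\mathrm{tr}_d(1)=1$; (3) $\mathrm{tr}_d(ag_n)=z\,\mathrm{tr}_d(a)$ for $a\in\mathrm Y_{d,n}(q)$, $n\ge1$; (4) $\mathrm{tr}_d(at_{n+1}^s)=x_s\,\mathrm{tr}_d(a)$ for $a\in\mathrm Y_{d,n}(q)$, $1\le s\le d-1$. Let $a\mapsto\overleftarrow a$ be inversion, which writes words from right to left: the linear anti-automorphism of $\mathrm Y_{d,n}(q)$ (respectively the anti-automorphism of the group $\mathcal F_n$) that fixes all generators $g_i$ (respectively $\sigma_i$) and $t_j$. Then the trace $\mathrm{tr}_d$ is invariant under inversion: for all $n$, $$\mathrm{tr}_d(a)=\mathrm{tr}_d(\overleftarrow a)\qquad\text{for all }a\in\mathrm Y_{d,n}(q).$$ In particular $\mathrm{tr}_d(\alpha)=\mathrm{tr}_d(\overleftarrow\alpha)$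 for all framed braids $\alpha\in\mathcal F_n$, where $\mathrm{tr}_d$ is evaluated on $\mathcal F_n$ through the natural map $\mathcal F_n\to\mathrm Y_{d,n}(q)$. -/

import Mathlib

noncomputable section

namespace YokonumaHecke

/-! Strands are numbered from `0`: `σ i` (with `i + 1 < n`) is the braiding generator that
exchanges the strands `i` and `i + 1`, and `t j` is the framing generator of the strand `j`. -/

/-- The generators of the framed braid group on `n` strands. -/
inductive Gen (n : ℕ) : Type
  | σ (i : ℕ) (hi : i + 1 < n) : Gen n
  | t (j : Fin n) : Gen n

/-- The braiding generator as an element of the free group. -/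
def fσ {n : ℕ} (i : ℕ) (hi : i + 1 < n) : FreeGroup (Gen n) := FreeGroup.of (Gen.σ i hi)

/-- The framing generator as an element of the free group. -/
def ft {n : ℕ} (j : Fin n) : FreeGroup (Gen n) := FreeGroup.of (Gen.t j)

/-- The transposition `s_i = (i, i + 1)` of the strands. -/
def strandSwap {n : ℕ} (i : ℕ) (hi : i + 1 < n) : Equiv.Perm (Fin n) :=
  Equiv.swap ⟨i, by omega⟩ ⟨i + 1, hi⟩

/-- The defining relations (left side, right side) of the framed braid group. -/
inductive FramedRel (n : ℕ) : FreeGroup (Gen n) → FreeGroup (Gen n) → Prop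
  | b₁ (i j : ℕ) (hi : i + 1 < n) (hj : j + 1 < n) (hij : i + 1 = j ∨ j + 1 = i) :
      FramedRel n (fσ i hi * fσ j hj * fσ i hi) (fσ j hj * fσ i hi * fσ j hj)
  | b₂ (i j : ℕ) (hi : i + 1 < n) (hj : j + 1 < n) (hij : i + 1 < j ∨ j + 1 < i) :
      FramedRel n (fσ i hi * fσ j hj) (fσ j hj * fσ i hi)
  | f₁ (i j : Fin n) : FramedRel n (ft i * ft j) (ft j * ft i)
  | f₂ (i : ℕ) (hi : i + 1 < n) (j : Fin n) :
      FramedRel n (ft j * fσ i hi) (fσ i hi * ft (strandSwap i hi j))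

/-- The defining relations of the modular framed braid group: those of the framed braid group
and `t_j ^ d = 1`. -/
inductive ModularRel (d n : ℕ) : FreeGroup (Gen n) → FreeGroup (Gen n) → Prop
  | framed {u v : FreeGroup (Gen n)} (h : FramedRel n u v) : ModularRel d n u v
  | m (j : Fin n) : ModularRel d n (ft j ^ d) 1

/-- The relators `u * v⁻¹` of a family of relations `u = v`. -/
def relators {α : Type} (r : FreeGroup α → FreeGroup α → Prop) : Set (FreeGroup α) :=
  {w | ∃ u v, r u v ∧ w = u * v⁻¹}

/-- The framed braid group `F_n`. -/
abbrev FramedBraidGroup (n : ℕ) : Type := PresentedGroup (relators (FramedRel n))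

/-- The modular framed braid group `F_{d,n}`. -/
abbrev ModularFramedBraidGroup (d n : ℕ) : Type := PresentedGroup (relators (ModularRel d n))

/-- A map on generators that respects a family of relations extends to the presented group. -/
def liftRel {α : Type} {r : FreeGroup α → FreeGroup α → Prop} {G : Type} [Group G] (f : α → G)
    (h : ∀ u v, r u v → FreeGroup.lift f u = FreeGroup.lift f v) :
    PresentedGroup (relators r) →* G :=
  PresentedGroup.toGroup (f := f) (by
    rintro w ⟨u, v, huv, rfl⟩
    simp [h u v huv])

@[simp] theorem liftRel_of {α : Type} {r : FreeGroup α → FreeGroup α → Prop} {G : Type} [Group G]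
    (f : α → G) (h : ∀ u v, r u v → FreeGroup.lift f u = FreeGroup.lift f v) (x : α) :
    liftRel f h (PresentedGroup.of x) = f x :=
  PresentedGroup.toGroup.of _

theorem lift_of_eq {α : Type} {r : FreeGroup α → FreeGroup α → Prop} {u v : FreeGroup α}
    (h : r u v) :
    FreeGroup.lift (fun x => (PresentedGroup.of x : PresentedGroup (relators r))) u =
      FreeGroup.lift (fun x => (PresentedGroup.of x : PresentedGroup (relators r))) v := by
  have key : FreeGroup.lift (fun x => (PresentedGroup.of x : PresentedGroup (relators r))) =
      PresentedGroup.mk (relators r) := by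
    ext x; simp [PresentedGroup.of]
  rw [key]
  have : PresentedGroup.mk (relators r) (u * v⁻¹) = 1 :=
    PresentedGroup.one_of_mem ⟨u, v, h, rfl⟩
  rw [map_mul, map_inv] at this
  exact mul_inv_eq_one.mp this

/-- The braiding generator `σ_i` of `F_{d,n}`. -/
def mσ (d : ℕ) {n : ℕ} (i : ℕ) (hi : i + 1 < n) : ModularFramedBraidGroup d n :=
  PresentedGroup.of (Gen.σ i hi)

/-- The framing generator `t_j` of `F_{d,n}`. -/
def mt (d : ℕ) {n : ℕ} (j : Fin n) : ModularFramedBraidGroup d n :=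
  PresentedGroup.of (Gen.t j)

/-- The natural epimorphism `F_n → F_{d,n}`. -/
def toModular (d n : ℕ) : FramedBraidGroup n →* ModularFramedBraidGroup d n :=
  liftRel (fun x => PresentedGroup.of x) (fun _ _ h => lift_of_eq (ModularRel.framed h))

/-! ### Relations in the modular framed braid group -/

theorem mσ_braid (d : ℕ) {n : ℕ} (i j : ℕ) (hi : i + 1 < n) (hj : j + 1 < n)
    (hij : i + 1 = j ∨ j + 1 = i) :
    mσ d i hi * mσ d j hj * mσ d i hi = mσ d j hj * mσ d i hi * mσ d j hj := by
  simpa [fσ, mσ] using lift_of_eq (ModularRel.framed (d := d) (FramedRel.b₁ i j hi hj hij))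

theorem mσ_comm (d : ℕ) {n : ℕ} (i j : ℕ) (hi : i + 1 < n) (hj : j + 1 < n)
    (hij : i + 1 < j ∨ j + 1 < i) :
    mσ d i hi * mσ d j hj = mσ d j hj * mσ d i hi := by
  simpa [fσ, mσ] using lift_of_eq (ModularRel.framed (d := d) (FramedRel.b₂ i j hi hj hij))

theorem mt_comm (d : ℕ) {n : ℕ} (i j : Fin n) : mt d i * mt d j = mt d j * mt d i := by
  simpa [ft, mt] using lift_of_eq (ModularRel.framed (d := d) (FramedRel.f₁ i j))

theorem mt_mul_mσ (d : ℕ) {n : ℕ} (i : ℕ) (hi : i + 1 < n) (j : Fin n) :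
    mt d j * mσ d i hi = mσ d i hi * mt d (strandSwap i hi j) := by
  simpa [ft, fσ, mt, mσ] using lift_of_eq (ModularRel.framed (d := d) (FramedRel.f₂ i hi j))

theorem mt_pow (d : ℕ) {n : ℕ} (j : Fin n) : mt d j ^ d = 1 := by
  simpa [ft, mt] using lift_of_eq (ModularRel.m (d := d) j)

/-! ### The Yokonuma–Hecke algebra -/

/-- The element `e_i = (1/d) ∑_{s=1}^{d} t_i^s t_{i+1}^{-s}` of `ℂ F_{d,n}`. -/
def e (d : ℕ) {n : ℕ} (i : ℕ) (hi : i + 1 < n) :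
    MonoidAlgebra ℂ (ModularFramedBraidGroup d n) :=
  (d : ℂ)⁻¹ • ∑ s ∈ Finset.Icc 1 d,
    MonoidAlgebra.of ℂ _ (mt d ⟨i, by omega⟩ ^ s * (mt d ⟨i + 1, hi⟩ ^ s)⁻¹)

/-- The braiding generator `σ_i` in `ℂ F_{d,n}`. -/
def aσ (d : ℕ) {n : ℕ} (i : ℕ) (hi : i + 1 < n) :
    MonoidAlgebra ℂ (ModularFramedBraidGroup d n) :=
  MonoidAlgebra.of ℂ _ (mσ d i hi)

/-- The quadratic relations `σ_i² = 1 + (q - q⁻¹) e_i σ_i`. -/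
inductive QuadRel (d n : ℕ) (q : ℂ) :
    MonoidAlgebra ℂ (ModularFramedBraidGroup d n) →
      MonoidAlgebra ℂ (ModularFramedBraidGroup d n) → Prop
  | quad (i : ℕ) (hi : i + 1 < n) :
      QuadRel d n q (aσ d i hi ^ 2) (1 + (q - q⁻¹) • (e d i hi * aσ d i hi))

/-- The Yokonuma–Hecke algebra `Y_{d,n}(q)`: the quotient of `ℂ F_{d,n}` by the two-sided ideal
generated by the elements `σ_i² - 1 - (q - q⁻¹) e_i σ_i`. -/
abbrev YH (d n : ℕ) (q : ℂ) : Type := RingQuot (QuadRel d n q)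

/-- The natural map `F_{d,n} → Y_{d,n}(q)`. -/
def ofModular (d n : ℕ) (q : ℂ) : ModularFramedBraidGroup d n →* YH d n q :=
  ((RingQuot.mkAlgHom ℂ (QuadRel d n q) : _ →* YH d n q)).comp (MonoidAlgebra.of ℂ _)

/-- The natural map `F_n → Y_{d,n}(q)`. -/
def ofFramedBraid (d n : ℕ) (q : ℂ) : FramedBraidGroup n →* YH d n q :=
  (ofModular d n q).comp (toModular d n)

/-- The element `g_i` of `Y_{d,n}(q)`. -/
def g (d : ℕ) {n : ℕ} (q : ℂ) (i : ℕ) (hi : i + 1 < n) : YH d n q := ofModular d n q (mσ d i hi)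

/-- The element `t_j` of `Y_{d,n}(q)`. -/
def t (d : ℕ) {n : ℕ} (q : ℂ) (j : Fin n) : YH d n q := ofModular d n q (mt d j)

theorem mkAlgHom_of (d n : ℕ) (q : ℂ) (x : ModularFramedBraidGroup d n) :
    RingQuot.mkAlgHom ℂ (QuadRel d n q) (MonoidAlgebra.of ℂ _ x) = ofModular d n q x := rfl

theorem quad_eq (d n : ℕ) (q : ℂ) (i : ℕ) (hi : i + 1 < n) :
    ofModular d n q (mσ d i hi) ^ 2 = 1 + (q - q⁻¹) • ((d : ℂ)⁻¹ • ∑ s ∈ Finset.Icc 1 d,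
      ofModular d n q (mt d ⟨i, by omega⟩ ^ s * (mt d ⟨i + 1, hi⟩ ^ s)⁻¹) *
        ofModular d n q (mσ d i hi)) := by
  have h := RingQuot.mkAlgHom_rel ℂ (QuadRel.quad (q := q) (d := d) i hi)
  simp only [e, aσ, map_pow, map_add, map_one, map_smul, map_mul, map_sum,
    mkAlgHom_of, Finset.sum_mul, smul_mul_assoc] at h ⊢
  exact h

/-! ### The natural inclusions -/

/-- The inclusion `F_{d,n} → F_{d,n+1}` that adds a last strand. -/
def modularIncl (d n : ℕ) : ModularFramedBraidGroup d n →* ModularFramedBraidGroup d (n + 1) :=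
  liftRel
    (fun x => match x with
      | Gen.σ i hi => mσ d i (Nat.lt_succ_of_lt hi)
      | Gen.t j => mt d j.castSucc)
    (by
      rintro u v (h | ⟨j⟩)
      · cases h with
        | b₁ i j hi hj hij => simpa [fσ] using mσ_braid d i j _ _ hij
        | b₂ i j hi hj hij => simpa [fσ] using mσ_comm d i j _ _ hij
        | f₁ i j => simpa [ft] using mt_comm d _ _
        | f₂ i hi j =>
          have hs : (strandSwap i hi j).castSucc =
              strandSwap i (Nat.lt_succ_of_lt hi) j.castSucc := by
            simp only [strandSwap, Equiv.swap_apply_def, Fin.ext_iff]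
            split_ifs <;> simp_all
          simpa [ft, fσ, hs] using mt_mul_mσ d i _ j.castSucc
      · simpa [ft] using mt_pow d j.castSucc)

/-- The natural inclusion `Y_{d,n}(q) → Y_{d,n+1}(q)`, with `g_i ↦ g_i` and `t_j ↦ t_j`. -/
def incl (d n : ℕ) (q : ℂ) : YH d n q →ₐ[ℂ] YH d (n + 1) q :=
  RingQuot.liftAlgHom ℂ
    ⟨MonoidAlgebra.lift ℂ _ _ ((ofModular d (n + 1) q).comp (modularIncl d n)), by
      rintro x y ⟨i, hi⟩
      have h := quad_eq d (n + 1) q i (Nat.lt_succ_of_lt hi)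
      simp only [e, aσ, map_pow, map_add, map_one, map_smul, map_mul, map_sum, map_inv,
        Finset.sum_mul, smul_mul_assoc, MonoidAlgebra.lift_of, MonoidHom.comp_apply]
      simpa [modularIncl, mσ, mt, Finset.sum_mul] using h⟩

/-! ### Inversion (writing words from right to left) -/

/-- Inversion on the framed braid group, as a homomorphism to the opposite group: the
anti-automorphism with `σ_i ↦ σ_i` and `t_j ↦ t_j`. -/
def framedReverseHom (n : ℕ) : FramedBraidGroup n →* (FramedBraidGroup n)ᵐᵒᵖ :=
  liftRel (fun x => MulOpposite.op (PresentedGroup.of x)) (by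
    intro u v h
    apply MulOpposite.unop_injective
    cases h with
    | b₁ i j hi hj hij =>
      simpa [fσ, mul_assoc] using lift_of_eq (FramedRel.b₁ i j hi hj hij)
    | b₂ i j hi hj hij =>
      simpa [fσ] using lift_of_eq (FramedRel.b₂ j i hj hi hij.symm)
    | f₁ i j => simpa [ft] using lift_of_eq (FramedRel.f₁ j i)
    | f₂ i hi j =>
      have h := lift_of_eq (FramedRel.f₂ i hi (strandSwap i hi j))
      rw [show strandSwap i hi (strandSwap i hi j) = j by simp [strandSwap]] at h
      simpa [ft, fσ] using h.symm)

/-- The inverted framed braid: `σ_i` and `t_j` are kept and words are written from right to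
left. -/
def framedReverse (n : ℕ) (α : FramedBraidGroup n) : FramedBraidGroup n :=
  (framedReverseHom n α).unop

/-- Inversion on the modular framed braid group, as a homomorphism to the opposite group. -/
def modularReverseHom (d n : ℕ) :
    ModularFramedBraidGroup d n →* (ModularFramedBraidGroup d n)ᵐᵒᵖ :=
  liftRel (fun x => MulOpposite.op (PresentedGroup.of x)) (by
    rintro u v (h | ⟨j⟩)
    · apply MulOpposite.unop_injective
      cases h with
      | b₁ i j hi hj hij =>
        simpa [fσ, mσ, mul_assoc] using mσ_braid d i j hi hj hij
      | b₂ i j hi hj hij =>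
        simpa [fσ, mσ] using mσ_comm d j i hj hi hij.symm
      | f₁ i j => simpa [ft, mt] using mt_comm d j i
      | f₂ i hi j =>
        have h := mt_mul_mσ d i hi (strandSwap i hi j)
        rw [show strandSwap i hi (strandSwap i hi j) = j by simp [strandSwap]] at h
        simpa [ft, fσ, mt, mσ] using h.symm
    · apply MulOpposite.unop_injective
      simpa [ft, mt] using mt_pow d j)

theorem mσ_mul_frame (d : ℕ) {n : ℕ} (i : ℕ) (hi : i + 1 < n) (s : ℕ) (hs : s ≤ d) :
    mσ d i hi * ((mt d ⟨i + 1, hi⟩ ^ s)⁻¹ * mt d ⟨i, by omega⟩ ^ s) =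
      mt d ⟨i, by omega⟩ ^ (d - s) * (mt d ⟨i + 1, hi⟩ ^ (d - s))⁻¹ * mσ d i hi := by
  have h0 : mt d ⟨i, by omega⟩ * mσ d i hi = mσ d i hi * mt d ⟨i + 1, hi⟩ := by
    have := mt_mul_mσ d i hi ⟨i, by omega⟩
    simpa [strandSwap] using this
  have h1 : mt d ⟨i + 1, hi⟩ * mσ d i hi = mσ d i hi * mt d ⟨i, by omega⟩ := by
    have := mt_mul_mσ d i hi ⟨i + 1, hi⟩
    simpa [strandSwap] using this
  have hc : Commute (mt d (⟨i, by omega⟩ : Fin n)) (mt d ⟨i + 1, hi⟩) := mt_comm d _ _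
  have hp (j : Fin n) : mt d j ^ (d - s) = (mt d j ^ s)⁻¹ := by
    rw [eq_inv_iff_mul_eq_one, ← pow_add, Nat.sub_add_cancel hs, mt_pow]
  have hs0 : SemiconjBy (mσ d i hi) (mt d ⟨i + 1, hi⟩) (mt d ⟨i, by omega⟩) := h0.symm
  have hs1 : SemiconjBy (mσ d i hi) (mt d ⟨i, by omega⟩) (mt d ⟨i + 1, hi⟩) := h1.symm
  rw [hp, hp, inv_inv]
  exact ((hs0.pow_right s).inv_right.mul_right (hs1.pow_right s)).eq

theorem sum_Icc_reflect {M : Type} [AddCommGroup M] (d : ℕ) (f : ℕ → M) (h : f 0 = f d) :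
    ∑ s ∈ Finset.Icc 1 d, f s = ∑ s ∈ Finset.Icc 1 d, f (d - s) := by
  have h1 : ∑ s ∈ Finset.Icc 1 d, f s = ∑ k ∈ Finset.range d, f (k + 1) := by
    rw [← Finset.Ico_add_one_right_eq_Icc, Finset.sum_Ico_eq_sum_range]
    simp [add_comm]
  have h2 : ∑ s ∈ Finset.Icc 1 d, f (d - s) = ∑ k ∈ Finset.range d, f (d - 1 - k) := by
    rw [← Finset.Ico_add_one_right_eq_Icc, Finset.sum_Ico_eq_sum_range]
    simp [Nat.sub_sub]
  have h3 := Finset.sum_range_succ f d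
  rw [Finset.sum_range_succ', h] at h3
  rw [h1, h2, Finset.sum_range_reflect]
  exact add_right_cancel h3

/-- Inversion on `Y_{d,n}(q)`, as an algebra homomorphism to the opposite algebra: the
anti-automorphism with `g_i ↦ g_i` and `t_j ↦ t_j`. -/
def reverseHom (d n : ℕ) (q : ℂ) : YH d n q →ₐ[ℂ] (YH d n q)ᵐᵒᵖ :=
  RingQuot.liftAlgHom ℂ
    ⟨MonoidAlgebra.lift ℂ _ _
      ((MonoidHom.op (ofModular d n q)).comp (modularReverseHom d n)), by
      rintro x y ⟨i, hi⟩
      apply MulOpposite.unop_injective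
      have h := quad_eq d n q i hi
      have hrσ : modularReverseHom d n (mσ d i hi) = MulOpposite.op (mσ d i hi) :=
        liftRel_of _ _ _
      have hrt (j : Fin n) : modularReverseHom d n (mt d j) = MulOpposite.op (mt d j) :=
        liftRel_of _ _ _
      simp only [e, aσ, map_pow, map_add, map_one, map_smul, map_mul, map_sum, map_inv,
        Finset.sum_mul, smul_mul_assoc, MonoidAlgebra.lift_of, MonoidHom.comp_apply, hrσ, hrt]
      simp only [MulOpposite.unop_add, MulOpposite.unop_smul, Finset.unop_sum,
        MulOpposite.unop_one,
        ← MulOpposite.op_pow, ← MulOpposite.op_inv, ← MulOpposite.op_mul,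
        MonoidHom.op_apply_apply, MulOpposite.unop_op, Function.comp]
      rw [h]
      simp only [← map_mul]
      congr 3
      rw [sum_Icc_reflect d _ (by simp [mt_pow])]
      refine Finset.sum_congr rfl fun s hs => ?_
      rw [← map_pow, ← map_mul, ← map_mul, mσ_mul_frame d i hi s (Finset.mem_Icc.mp hs).2]⟩

/-- The inversion map `a ↦ a` written from right to left on `Y_{d,n}(q)`. -/
def reverse (d n : ℕ) (q : ℂ) : YH d n q →ₗ[ℂ] YH d n q :=
  (MulOpposite.opLinearEquiv ℂ).symm.toLinearMap ∘ₗ (reverseHom d n q).toLinearMap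

theorem reverse_mul (d n : ℕ) (q : ℂ) (a b : YH d n q) :
    reverse d n q (a * b) = reverse d n q b * reverse d n q a := by
  simp [reverse]

theorem reverse_g (d n : ℕ) (q : ℂ) (i : ℕ) (hi : i + 1 < n) :
    reverse d n q (g d q i hi) = g d q i hi := by
  have h : modularReverseHom d n (mσ d i hi) = MulOpposite.op (mσ d i hi) := liftRel_of _ _ _
  simp [reverse, reverseHom, g, ofModular, h, MonoidAlgebra.lift_of, -MonoidAlgebra.of_apply]

theorem reverse_t (d n : ℕ) (q : ℂ) (j : Fin n) :
    reverse d n q (t d q j) = t d q j := by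
  have h : modularReverseHom d n (mt d j) = MulOpposite.op (mt d j) := liftRel_of _ _ _
  simp [reverse, reverseHom, t, ofModular, h, MonoidAlgebra.lift_of, -MonoidAlgebra.of_apply]

/-! ### The trace -/

/-- The indeterminates `z, x_1, …, x_{d-1}`. -/
inductive TraceVar (d : ℕ) : Type
  | z : TraceVar d
  | x (s : ℕ) (h₁ : 1 ≤ s) (h₂ : s < d) : TraceVar d

/-- The polynomial ring `ℂ[z, x_1, …, x_{d-1}]`. -/
abbrev TraceRing (d : ℕ) : Type := MvPolynomial (TraceVar d) ℂ

/-- `tr` is a Markov trace `⋃ₙ Y_{d,n}(q) → ℂ[z, x_1, …, x_{d-1}]`. A linear map on the union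
is a family of linear maps on the `Y_{d,n}(q)` compatible with the natural inclusions. With
strands numbered from `0`, the generator `g_n` of `Y_{d,n+1}(q)` of the usual numbering is
`g (n - 1)`; so, with `n = m + 1` in `markov`, it is `g m`, and `t_{n+1}` is `t (Fin.last n)`. -/
structure IsMarkovTrace (d : ℕ) (q : ℂ) (tr : (n : ℕ) → YH d n q →ₗ[ℂ] TraceRing d) : Prop where
  compat : ∀ (n : ℕ) (a : YH d n q), tr (n + 1) (incl d n q a) = tr n a
  comm : ∀ (n : ℕ) (a b : YH d n q), tr n (a * b) = tr n (b * a)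
  one : ∀ n : ℕ, tr n 1 = 1
  markov : ∀ (m : ℕ) (a : YH d (m + 1) q),
    tr (m + 2) (incl d (m + 1) q a * g d q m (Nat.lt_succ_self (m + 1))) =
      MvPolynomial.X TraceVar.z * tr (m + 1) a
  framing : ∀ (n : ℕ) (a : YH d n q) (s : ℕ) (h₁ : 1 ≤ s) (h₂ : s < d),
    tr (n + 1) (incl d n q a * t d q (Fin.last n) ^ s) =
      MvPolynomial.X (TraceVar.x s h₁ h₂) * tr n a

end YokonumaHecke

end

noncomputable section

namespace YokonumaHecke

/-! ### Averages of powers -/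

/-! Invariance follows from uniqueness. Inversion is an anti-automorphism that fixes the generators
and commutes with the inclusions. A trace does not see the order of two factors, so a Markov trace
composed with inversion obeys the same rules (`IsMarkovTrace.reverse`) and equals the original by
`IsMarkovTrace.unique`. Framed braids inherit this because the natural map intertwines the two
inversions. The work lies in proving uniqueness and, above all, existence.

Uniqueness: with strands numbered from 0, Y_{n+1} is spanned by the elements a t_n^s and a g_{n-1} b
with a, b in Y_n (`mem_markovSpan`), and the rules express the trace of each through the trace on
Y_n.

Existence: put tr_{n+1}(y) = ∑ x_s tr_n(E_s y) + z tr_n(F y), with x_0 = 1, where E_s (`condExp`)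
and F (`braidExp`) are Y_n-bimodule maps Y_{n+1} → Y_n. E_s kills g_{n-1} and picks out t_n^s among
the powers of t_n; F kills these powers and sends g_{n-1} to 1. To obtain them without a basis
theorem, Y_{n+1} is made to act on a model of itself (`YHFamily.coset`): sums of m_k f_k for 0 ≤ k ≤
n, with f_k in Y_n[τ]/(τ^d = 1), where m_k stands for g_k ⋯ g_{n-1} and τ for t_n. The maps are read
off from the image of m_n = 1.

The trace property goes by induction on the number of strands. The hard case is commuting with the
last crossing g, which reduces to the symmetry of tr(g a g b) in a and b (`markovTrace_symm`). This
is checked on spanning elements; if both contain a crossing, what remains is to move an idempotent e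
from one crossing to another (`markovTrace_move_avg`). -/

/-- The average `(1/d) ∑_{s<d} u^s v^{d-s}`. -/
def frameAvg (d : ℕ) {A : Type} [Ring A] [Algebra ℂ A] (u v : A) : A :=
  (d : ℂ)⁻¹ • ∑ s ∈ Finset.range d, u ^ s * v ^ (d - s)

section frameAvg

variable {d : ℕ} {A B : Type} [Ring A] [Algebra ℂ A] [Ring B] [Algebra ℂ B]

/-- An intertwining relation passes to powers and then to the average. A merely linear `L` is
allowed because the lemma is also applied to `frameEval`, which need not be multiplicative. -/
theorem linearMap_frameAvg_mul (L : B →ₗ[ℂ] A) {x y : B} {x' y' : A}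
    (hx : ∀ b, L (x * b) = x' * L b) (hy : ∀ b, L (y * b) = y' * L b) (b : B) :
    L (frameAvg d x y * b) = frameAvg d x' y' * L b := by
  have key {x : B} {x' : A} (hx : ∀ b, L (x * b) = x' * L b) (k : ℕ) (b : B) :
      L (x ^ k * b) = x' ^ k * L b := by
    induction k generalizing b with
    | zero => simp
    | succ k ih => rw [pow_succ, pow_succ, mul_assoc, mul_assoc, ih, hx]
  simp only [frameAvg, smul_mul_assoc, Finset.sum_mul, map_smul, map_sum, mul_assoc, key hx,
    key hy]

theorem algHom_frameAvg (φ : B →ₐ[ℂ] A) (x y : B) :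
    φ (frameAvg d x y) = frameAvg d (φ x) (φ y) := by
  simp [frameAvg]

theorem mul_frameAvg {x u v u' v' : A} (hu : x * u = u' * x) (hv : x * v = v' * x) :
    x * frameAvg d u v = frameAvg d u' v' * x := by
  simpa using linearMap_frameAvg_mul (d := d) (LinearMap.mulLeft ℂ x) (x := u) (y := v) (x' := u')
    (y' := v') (fun b => by simp [← mul_assoc, hu]) (fun b => by simp [← mul_assoc, hv]) 1

/-- The reflection s ↦ d - s exchanges the roles of u and v. It acts on the range 1, …, d, which may
replace 0, …, d - 1 because the terms s = 0 and s = d agree. -/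
theorem frameAvg_comm {u v : A} (h : Commute u v) (hu : u ^ d = 1) (hv : v ^ d = 1) :
    frameAvg d u v = frameAvg d v u := by
  have key (u v : A) (hu : u ^ d = 1) (hv : v ^ d = 1) :
      ∑ s ∈ Finset.range d, u ^ s * v ^ (d - s) = ∑ s ∈ Finset.Icc 1 d, u ^ s * v ^ (d - s) := by
    have h1 := Finset.sum_range_succ (fun s => u ^ s * v ^ (d - s)) d
    rw [Finset.sum_range_succ'] at h1
    simp only [pow_zero, Nat.sub_zero, hv, hu, Nat.sub_self, mul_one] at h1
    rw [← add_right_cancel h1, ← Finset.Ico_add_one_right_eq_Icc, Finset.sum_Ico_eq_sum_range]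
    simp [add_comm]
  unfold frameAvg
  rw [key u v hu hv, key v u hv hu, sum_Icc_reflect d _ (by simp [hu, hv])]
  congr 1
  refine Finset.sum_congr rfl fun s hs => ?_
  rw [Nat.sub_sub_self (Finset.mem_Icc.mp hs).2]
  exact ((h.pow_pow _ _).eq)

end frameAvg

/-! ### Families of elements that satisfy the Yokonuma–Hecke relations -/

/-- The elements `g 0, …, g (n - 2)` and `t 0, …, t (n - 1)` of `A` satisfy the defining relations
of `Y_{d,n}(q)`. -/
structure YHFamily (d n : ℕ) (q : ℂ) {A : Type} [Ring A] [Algebra ℂ A] (g t : ℕ → A) : Prop where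
  braid : ∀ i, i + 2 < n → g i * g (i + 1) * g i = g (i + 1) * g i * g (i + 1)
  far : ∀ i j, i + 1 < j → j + 1 < n → g i * g j = g j * g i
  t_comm : ∀ i j, i < n → j < n → t i * t j = t j * t i
  t_g_left : ∀ i, i + 1 < n → t i * g i = g i * t (i + 1)
  t_g_right : ∀ i, i + 1 < n → t (i + 1) * g i = g i * t i
  t_g_far : ∀ i j, i + 1 < n → j < n → j ≠ i → j ≠ i + 1 → t j * g i = g i * t j
  t_pow : ∀ j, j < n → t j ^ d = 1
  quad : ∀ i, i + 1 < n → g i * g i = 1 + (q - q⁻¹) • (frameAvg d (t i) (t (i + 1)) * g i)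

namespace YHFamily

variable {d n : ℕ} {q : ℂ} {A : Type} [Ring A] [Algebra ℂ A] {g t : ℕ → A}

/-- The crossing exchanges the two framings, and the average is symmetric in them. -/
theorem avg_g_comm (h : YHFamily d n q g t) (i : ℕ) (hi : i + 1 < n) :
    g i * frameAvg d (t i) (t (i + 1)) = frameAvg d (t i) (t (i + 1)) * g i := by
  rw [mul_frameAvg (h.t_g_right i hi).symm (h.t_g_left i hi).symm,
    frameAvg_comm (h.t_comm _ _ (by omega) (by omega)) (h.t_pow _ (by omega))
      (h.t_pow _ (by omega))]

theorem g_mul_inv (h : YHFamily d n q g t) (i : ℕ) (hi : i + 1 < n) :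
    g i * (g i - (q - q⁻¹) • frameAvg d (t i) (t (i + 1))) = 1 := by
  rw [mul_sub, mul_smul_comm, h.avg_g_comm i hi, h.quad i hi, add_sub_cancel_right]

theorem g_inv_mul (h : YHFamily d n q g t) (i : ℕ) (hi : i + 1 < n) :
    (g i - (q - q⁻¹) • frameAvg d (t i) (t (i + 1))) * g i = 1 := by
  rw [sub_mul, smul_mul_assoc, h.quad i hi, add_sub_cancel_right]

/-- The generator `g i` as a unit. -/
def gUnit (h : YHFamily d n q g t) (i : ℕ) (hi : i + 1 < n) : Aˣ :=
  ⟨g i, g i - (q - q⁻¹) • frameAvg d (t i) (t (i + 1)), h.g_mul_inv i hi, h.g_inv_mul i hi⟩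

/-- The generator `t j` as a unit. -/
def tUnit (h : YHFamily d n q g t) (hd : 1 ≤ d) (j : ℕ) (hj : j < n) : Aˣ :=
  ⟨t j, t j ^ (d - 1), by rw [← pow_succ', Nat.sub_add_cancel hd, h.t_pow j hj],
    by rw [← pow_succ, Nat.sub_add_cancel hd, h.t_pow j hj]⟩

/-- The group homomorphism from the modular framed braid group given by a family. -/
def groupHom (h : YHFamily d n q g t) (hd : 1 ≤ d) : ModularFramedBraidGroup d n →* Aˣ :=
  liftRel
    (fun x => match x with
      | Gen.σ i hi => h.gUnit i hi
      | Gen.t j => h.tUnit hd j j.2)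
    (by
      rintro u v (h' | ⟨j⟩)
      · cases h' with
        | b₁ i j hi hj hij =>
          rcases hij with rfl | rfl
          · simpa [fσ, Units.ext_iff, gUnit] using h.braid i (by omega)
          · simpa [fσ, Units.ext_iff, gUnit] using (h.braid j (by omega)).symm
        | b₂ i j hi hj hij =>
          rcases hij with hij | hij
          · simpa [fσ, Units.ext_iff, gUnit] using h.far i j hij hj
          · simpa [fσ, Units.ext_iff, gUnit] using (h.far j i hij hi).symm
        | f₁ i j => simpa [ft, Units.ext_iff, tUnit] using h.t_comm i j i.2 j.2
        | f₂ i hi j =>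
          obtain ⟨j, hj⟩ := j
          rcases eq_or_ne j i with rfl | h1
          · simpa [ft, fσ, Units.ext_iff, tUnit, gUnit, strandSwap] using h.t_g_left j hi
          rcases eq_or_ne j (i + 1) with rfl | h2
          · simpa [ft, fσ, Units.ext_iff, tUnit, gUnit, strandSwap] using h.t_g_right i hi
          · rw [show strandSwap i hi ⟨j, hj⟩ = ⟨j, hj⟩ from
              Equiv.swap_apply_of_ne_of_ne (by simpa using h1) (by simpa using h2)]
            simpa [ft, fσ, Units.ext_iff, tUnit, gUnit] using h.t_g_far i j hi hj h1 h2
      · simpa [ft, Units.ext_iff, tUnit] using h.t_pow j j.2)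

theorem groupHom_σ (h : YHFamily d n q g t) (hd : 1 ≤ d) (i : ℕ) (hi : i + 1 < n) :
    (h.groupHom hd (mσ d i hi) : A) = g i :=
  congrArg Units.val (liftRel_of _ _ _)

theorem groupHom_t (h : YHFamily d n q g t) (hd : 1 ≤ d) (j : Fin n) :
    (h.groupHom hd (mt d j) : A) = t j :=
  congrArg Units.val (liftRel_of _ _ _)

end YHFamily

/-- Links the idempotent e_i of the presentation, written with inverses, to `frameAvg`, which uses
only nonnegative powers and so makes sense in any algebra. -/
theorem sum_Icc_mul_inv {d : ℕ} {A : Type} [Ring A] [Algebra ℂ A] (u v : Aˣ) (hu : u ^ d = 1)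
    (hv : v ^ d = 1) :
    (d : ℂ)⁻¹ • ∑ s ∈ Finset.Icc 1 d, ((u ^ s * (v ^ s)⁻¹ : Aˣ) : A) =
      frameAvg d (u : A) (v : A) := by
  have h1 := Finset.sum_range_succ (fun s => ((u ^ s * (v ^ s)⁻¹ : Aˣ) : A)) d
  rw [Finset.sum_range_succ'] at h1
  simp only [pow_zero, hv, hu] at h1
  have h2 := add_right_cancel h1
  unfold frameAvg
  congr 1
  rw [← Finset.Ico_add_one_right_eq_Icc, Finset.sum_Ico_eq_sum_range]
  simp only [add_tsub_cancel_right, add_comm 1]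
  rw [h2]
  refine Finset.sum_congr rfl fun s hs => ?_
  have : (v ^ s)⁻¹ = v ^ (d - s) := by
    rw [inv_eq_iff_mul_eq_one, ← pow_add, Nat.add_sub_cancel' (Finset.mem_range.mp hs).le, hv]
  simp [this]

/-- A family that satisfies the Yokonuma–Hecke relations extends to the algebra. -/
def YHFamily.lift {d n : ℕ} {q : ℂ} {A : Type} [Ring A] [Algebra ℂ A] {g t : ℕ → A}
    (h : YHFamily d n q g t) (hd : 1 ≤ d) : YH d n q →ₐ[ℂ] A :=
  RingQuot.liftAlgHom ℂ
    ⟨MonoidAlgebra.lift ℂ _ _ ((Units.coeHom A).comp (h.groupHom hd)), by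
      rintro x y ⟨i, hi⟩
      have hq := h.quad i hi
      have hs := sum_Icc_mul_inv (d := d) (h.groupHom hd (mt d ⟨i, by omega⟩))
        (h.groupHom hd (mt d ⟨i + 1, hi⟩)) (by rw [← map_pow, mt_pow, map_one])
        (by rw [← map_pow, mt_pow, map_one])
      rw [h.groupHom_t, h.groupHom_t] at hs
      simp only [e, aσ, map_pow, map_add, map_one, map_smul, map_mul, map_sum,
        MonoidAlgebra.lift_of, MonoidHom.comp_apply, Units.coeHom_apply, h.groupHom_σ, pow_two, hq]
      rw [← hs]
      simp [Units.val_mul]⟩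

theorem YHFamily.lift_ofModular {d n : ℕ} {q : ℂ} {A : Type} [Ring A] [Algebra ℂ A] {g t : ℕ → A}
    (h : YHFamily d n q g t) (hd : 1 ≤ d) (x : ModularFramedBraidGroup d n) :
    h.lift hd (ofModular d n q x) = h.groupHom hd x := by
  simp [YHFamily.lift, ofModular, MonoidAlgebra.lift_of, -MonoidAlgebra.of_apply]

/-! ### Generators indexed by all natural numbers -/

/-- The generator `g_i` of `Y_{d,n}(q)`, or `1` when `i` is out of range. -/
def G (d n : ℕ) (q : ℂ) (i : ℕ) : YH d n q := if h : i + 1 < n then g d q i h else 1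

/-- The generator `t_j` of `Y_{d,n}(q)`, or `1` when `j` is out of range. -/
def T (d n : ℕ) (q : ℂ) (j : ℕ) : YH d n q := if h : j < n then t d q ⟨j, h⟩ else 1

theorem G_eq (d n : ℕ) (q : ℂ) {i : ℕ} (h : i + 1 < n) : G d n q i = g d q i h := dif_pos h

theorem T_eq (d n : ℕ) (q : ℂ) {j : ℕ} (h : j < n) : T d n q j = t d q ⟨j, h⟩ := dif_pos h

theorem YHFamily.lift_G {d n : ℕ} {q : ℂ} {A : Type} [Ring A] [Algebra ℂ A] {g t : ℕ → A}
    (h : YHFamily d n q g t) (hd : 1 ≤ d) {i : ℕ} (hi : i + 1 < n) :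
    h.lift hd (G d n q i) = g i := by
  rw [G_eq d n q hi, YokonumaHecke.g, h.lift_ofModular, h.groupHom_σ]

theorem YHFamily.lift_T {d n : ℕ} {q : ℂ} {A : Type} [Ring A] [Algebra ℂ A] {g t : ℕ → A}
    (h : YHFamily d n q g t) (hd : 1 ≤ d) {j : ℕ} (hj : j < n) :
    h.lift hd (T d n q j) = t j := by
  rw [T_eq d n q hj, YokonumaHecke.t, h.lift_ofModular, h.groupHom_t]

theorem yhFamily (d n : ℕ) (q : ℂ) : YHFamily d n q (G d n q) (T d n q) where
  braid i hi := by
    rw [G_eq _ _ _ hi, G_eq _ _ _ (show i + 1 < n by omega)]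
    simpa [g] using congrArg (ofModular d n q)
      (mσ_braid d i (i + 1) (by omega) hi (Or.inl rfl))
  far i j hij hj := by
    rw [G_eq _ _ _ hj, G_eq _ _ _ (show i + 1 < n by omega)]
    simpa [g] using congrArg (ofModular d n q) (mσ_comm d i j (by omega) hj (Or.inl hij))
  t_comm i j hi hj := by
    rw [T_eq _ _ _ hi, T_eq _ _ _ hj]
    simpa [t] using congrArg (ofModular d n q) (mt_comm d ⟨i, hi⟩ ⟨j, hj⟩)
  t_g_left i hi := by
    rw [G_eq _ _ _ hi, T_eq _ _ _ hi, T_eq _ _ _ (show i < n by omega)]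
    simpa [t, g, strandSwap] using
      congrArg (ofModular d n q) (mt_mul_mσ d i hi ⟨i, by omega⟩)
  t_g_right i hi := by
    rw [G_eq _ _ _ hi, T_eq _ _ _ hi, T_eq _ _ _ (show i < n by omega)]
    simpa [t, g, strandSwap] using congrArg (ofModular d n q) (mt_mul_mσ d i hi ⟨i + 1, hi⟩)
  t_g_far i j hi hj h1 h2 := by
    rw [G_eq _ _ _ hi, T_eq _ _ _ hj]
    have h := mt_mul_mσ d i hi ⟨j, hj⟩
    rw [show strandSwap i hi ⟨j, hj⟩ = ⟨j, hj⟩ from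
      Equiv.swap_apply_of_ne_of_ne (by simpa using h1) (by simpa using h2)] at h
    simpa [t, g] using congrArg (ofModular d n q) h
  t_pow j hj := by
    rw [T_eq _ _ _ hj]
    simpa [t] using congrArg (ofModular d n q) (mt_pow d ⟨j, hj⟩)
  quad i hi := by
    have h := quad_eq d n q i hi
    have hs := sum_Icc_mul_inv (d := d) (A := YH d n q)
      ((ofModular d n q).toHomUnits (mt d ⟨i, by omega⟩))
      ((ofModular d n q).toHomUnits (mt d ⟨i + 1, hi⟩)) (by rw [← map_pow, mt_pow, map_one])
      (by rw [← map_pow, mt_pow, map_one])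
    rw [G_eq _ _ _ hi, T_eq _ _ _ hi, T_eq _ _ _ (show i < n by omega), g, t, t, ← pow_two, h]
    simp only [← map_pow, ← map_inv, ← map_mul, MonoidHom.coe_toHomUnits] at hs
    rw [← hs, smul_mul_assoc, Finset.sum_mul]

/-- A subalgebra that contains the generators is everything. -/
theorem eq_top_of_generators {d n : ℕ} {q : ℂ} (hd : 1 ≤ d) (S : Subalgebra ℂ (YH d n q))
    (hG : ∀ i, i + 1 < n → G d n q i ∈ S) (hT : ∀ j, j < n → T d n q j ∈ S) : S = ⊤ := by
  have hf := yhFamily d n q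
  have avg (i : ℕ) (hi : i + 1 < n) : frameAvg d (T d n q i) (T d n q (i + 1)) ∈ S :=
    S.smul_mem (S.sum_mem fun s _ => S.mul_mem (S.pow_mem (hT _ (by omega)) _)
      (S.pow_mem (hT _ hi) _)) _
  -- Inverses of the group generators are polynomials in the generators, by the quadratic relation
  -- and by t^d = 1, so the subalgebra contains the image of the whole group.
  have inv_mem {x : ModularFramedBraidGroup d n} {y : YH d n q} (hy : y ∈ S)
      (h : ofModular d n q x * y = 1) : ofModular d n q x⁻¹ ∈ S := by
    have : ofModular d n q x⁻¹ = y := by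
      rw [← mul_one (ofModular d n q x⁻¹), ← h, ← mul_assoc, ← map_mul]; simp
    rwa [this]
  have gen (x : Gen n) : ofModular d n q (PresentedGroup.of x) ∈ S ∧
      ofModular d n q (PresentedGroup.of x)⁻¹ ∈ S := by
    cases x with
    | σ i hi =>
      refine ⟨by simpa only [G_eq _ _ _ hi, g, mσ] using hG i hi,
        inv_mem (S.sub_mem (hG i hi) (S.smul_mem (avg i hi) (q - q⁻¹))) ?_⟩
      have := hf.g_mul_inv i hi
      rwa [G_eq _ _ _ hi] at this ⊢
    | t j =>
      refine ⟨by simpa only [T_eq _ _ _ j.2, t, mt] using hT j j.2,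
        inv_mem (S.pow_mem (hT j j.2) (d - 1)) ?_⟩
      have := hf.t_pow j j.2
      rw [← mul_pow_sub_one (by omega : d ≠ 0), T_eq _ _ _ j.2] at this
      rwa [T_eq _ _ _ j.2]
  have grp (x : ModularFramedBraidGroup d n) : ofModular d n q x ∈ S := by
    obtain ⟨w, rfl⟩ := PresentedGroup.mk_surjective _ x
    induction w with
    | C1 => rw [map_one, map_one]; exact S.one_mem
    | of x => exact (gen x).1
    | inv_of x _ => exact (gen x).2
    | mul x y hx hy => rw [map_mul, map_mul]; exact S.mul_mem hx hy
  rw [eq_top_iff]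
  rintro y -
  obtain ⟨a, rfl⟩ := RingQuot.mkAlgHom_surjective ℂ (QuadRel d n q) y
  induction a using MonoidAlgebra.induction_on with
  | of x => exact grp x
  | add x y hx hy => rw [map_add]; exact S.add_mem hx hy
  | smul r x hx => rw [map_smul]; exact S.smul_mem hx r

theorem incl_ofModular (d n : ℕ) (q : ℂ) (x : ModularFramedBraidGroup d n) :
    incl d n q (ofModular d n q x) = ofModular d (n + 1) q (modularIncl d n x) := by
  simp [incl, ofModular, MonoidAlgebra.lift_of, -MonoidAlgebra.of_apply]

theorem incl_G (d n : ℕ) (q : ℂ) {i : ℕ} (hi : i + 1 < n) :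
    incl d n q (G d n q i) = G d (n + 1) q i := by
  rw [G_eq _ _ _ hi, G_eq _ _ _ (show i + 1 < n + 1 by omega), g, incl_ofModular]
  exact congrArg _ (liftRel_of _ _ _)

theorem incl_T (d n : ℕ) (q : ℂ) {j : ℕ} (hj : j < n) :
    incl d n q (T d n q j) = T d (n + 1) q j := by
  rw [T_eq _ _ _ hj, T_eq _ _ _ (show j < n + 1 by omega), t, incl_ofModular]
  exact congrArg _ (liftRel_of _ _ _)

/-! ### Further properties of the averages -/

section frameAvg

variable {d : ℕ} {A : Type} [Ring A] [Algebra ℂ A]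

/-- Multiplication by u shifts the summation index by one; the two end terms match because u^d = v^d
= 1. -/
theorem mul_frameAvg_absorb {u v : A} (h : Commute u v) (hu : u ^ d = 1) (hv : v ^ d = 1) :
    u * frameAvg d u v = v * frameAvg d u v := by
  have h1 := Finset.sum_range_succ (fun s => u ^ s * v ^ (d + 1 - s)) d
  rw [Finset.sum_range_succ'] at h1
  have h2 : u ^ 0 * v ^ (d + 1 - 0) = u ^ d * v ^ (d + 1 - d) := by
    simp [hu, pow_succ, hv]
  rw [h2] at h1
  have h3 := add_right_cancel h1
  simp only [frameAvg, mul_smul_comm, Finset.mul_sum]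
  congr 1
  calc ∑ s ∈ Finset.range d, u * (u ^ s * v ^ (d - s))
      = ∑ s ∈ Finset.range d, u ^ (s + 1) * v ^ (d + 1 - (s + 1)) := by
        refine Finset.sum_congr rfl fun s _ => ?_
        rw [← mul_assoc, pow_succ', Nat.add_sub_add_right]
    _ = _ := by
        rw [h3]
        refine Finset.sum_congr rfl fun s hs => ?_
        rw [Nat.succ_sub (Finset.mem_range.mp hs).le, pow_succ', ← mul_assoc, ← mul_assoc,
          (h.pow_left s).eq]

theorem commute_frameAvg {x u v : A} (hu : Commute x u) (hv : Commute x v) :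
    Commute x (frameAvg d u v) :=
  mul_frameAvg hu.eq hv.eq

/-- Next to the average of u and v, every power of v may be replaced by the same power of u. -/
theorem frameAvg_mul_eq {u v w : A} (huv : Commute u v) (huw : Commute u w) (hvw : Commute v w)
    (hu : u ^ d = 1) (hv : v ^ d = 1) :
    frameAvg d v w * frameAvg d u v = frameAvg d u w * frameAvg d u v := by
  have pw (s : ℕ) : v ^ s * frameAvg d u v = u ^ s * frameAvg d u v := by
    induction s with
    | zero => simp
    | succ s ih =>
      rw [pow_succ, mul_assoc, ← mul_frameAvg_absorb huv hu hv, ← mul_assoc,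
        ((huv.symm.pow_left s).eq), mul_assoc, ih, ← mul_assoc, ← pow_succ']
  unfold frameAvg at pw ⊢
  rw [smul_mul_assoc, smul_mul_assoc, Finset.sum_mul, Finset.sum_mul]
  congr 1
  refine Finset.sum_congr rfl fun s _ => ?_
  rw [(hvw.pow_pow s (d - s)).eq, mul_assoc, pw, ← mul_assoc, (huw.pow_pow s (d - s)).eq]

end frameAvg

/-! ### The coset representation -/

/-- The algebra `A[τ] / (τ ^ d = 1)`. -/
abbrev Frame (d : ℕ) (A : Type) [Ring A] : Type := AddMonoidAlgebra A (ZMod d)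

section coset

variable (d : ℕ) {A : Type} [Ring A]

/-- The central generator of `Frame d A`. -/
def frameVar : Frame d A := AddMonoidAlgebra.single 1 1

theorem frameVar_comm (x : Frame d A) : Commute (frameVar d) x :=
  AddMonoidAlgebra.single_commute (fun _ => add_comm _ _) (fun _ => Commute.one_left _) x

theorem frameVar_pow (s : ℕ) : frameVar d ^ s = AddMonoidAlgebra.single (s : ZMod d) (1 : A) := by
  simp [frameVar, AddMonoidAlgebra.single_pow]

theorem frameVar_pow_self : (frameVar d : Frame d A) ^ d = 1 := by
  rw [frameVar_pow, ZMod.natCast_self]; rfl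

variable [Algebra ℂ A]

/-- The constants in `Frame d A`. -/
def const : A →ₐ[ℂ] Frame d A := AddMonoidAlgebra.singleZeroAlgHom

variable (n : ℕ) (q : ℂ) (g t : ℕ → A)

/-- The action of the framing generator `t j` on the `k`-th coset. -/
def cosetDiag (j k : ℕ) : Frame d A :=
  if n < k then 1 else if k = j then frameVar d else
    if j < k then const d (t j) else const d (t (j - 1))

/-- The action of the framing generator `t j` on the coset module. -/
def cosetT (j : ℕ) : Module.End ℂ (ℕ → Frame d A) := Algebra.lmul ℂ _ (cosetDiag d n t j)

/-- The action of the braiding generator `g i` on the coset module. -/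
def cosetG (i : ℕ) : Module.End ℂ (ℕ → Frame d A) where
  -- These are the coordinates of g_i · ∑ m_k f_k: g_i m_k = m_k g_{i-1} for k < i, g_i m_i =
  -- m_{i+1} + (q - q⁻¹) e_i m_i, g_i m_{i+1} = m_i, and g_i m_k = m_k g_i for k > i + 1. Moving e_i
  -- to the right of m_i turns it into the average of τ and t_i. Coordinates k > n lie outside the
  -- model; there g acts by q and t by 1, a character compatible with all the relations.
  toFun f k := if n < k then q • f k else if k < i then const d (g (i - 1)) * f k else
    if k = i then f (i + 1) + (q - q⁻¹) • (frameAvg d (frameVar d) (const d (t i)) * f i) else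
      if k = i + 1 then f i else const d (g i) * f k
  map_add' f f' := by
    ext1 k
    simp only [Pi.add_apply]
    split_ifs <;> simp only [mul_add, smul_add, add_add_add_comm]
  map_smul' r f := by
    ext1 k
    simp only [Pi.smul_apply, RingHom.id_apply]
    split_ifs <;> simp only [mul_smul_comm, smul_add, smul_comm r]

variable {d n q g t}

theorem cosetDiag_out {j k : ℕ} (h : n < k) : cosetDiag d n t j k = 1 := by simp [cosetDiag, h]

theorem cosetDiag_self {j : ℕ} (h : j ≤ n) : cosetDiag d n t j j = frameVar d := by
  simp [cosetDiag, h.not_gt]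

theorem cosetDiag_lt {j k : ℕ} (h : k ≤ n) (hk : j < k) :
    cosetDiag d n t j k = const d (t j) := by
  simp [cosetDiag, h.not_gt, hk, hk.ne']

theorem cosetDiag_gt {j k : ℕ} (h : k ≤ n) (hk : k < j) :
    cosetDiag d n t j k = const d (t (j - 1)) := by
  simp [cosetDiag, h.not_gt, hk.not_gt, hk.ne]

theorem cosetT_apply (j k : ℕ) (f : ℕ → Frame d A) :
    cosetT d n t j f k = cosetDiag d n t j k * f k := rfl

theorem cosetG_out {i k : ℕ} (h : n < k) (f : ℕ → Frame d A) :
    cosetG d n q g t i f k = q • f k := by simp [cosetG, h]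

theorem cosetG_lt {i k : ℕ} (h : k ≤ n) (hk : k < i) (f : ℕ → Frame d A) :
    cosetG d n q g t i f k = const d (g (i - 1)) * f k := by simp [cosetG, h.not_gt, hk]

theorem cosetG_self {i : ℕ} (h : i ≤ n) (f : ℕ → Frame d A) :
    cosetG d n q g t i f i =
      f (i + 1) + (q - q⁻¹) • (frameAvg d (frameVar d) (const d (t i)) * f i) := by
  simp [cosetG, h.not_gt]

theorem cosetG_succ {i : ℕ} (h : i + 1 ≤ n) (f : ℕ → Frame d A) :
    cosetG d n q g t i f (i + 1) = f i := by
  simp [cosetG, h.not_gt]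

theorem cosetG_gt {i k : ℕ} (h : k ≤ n) (hk : i + 1 < k) (f : ℕ → Frame d A) :
    cosetG d n q g t i f k = const d (g i) * f k := by
  simp [cosetG, h.not_gt, show ¬ k < i by omega, show k ≠ i by omega, show k ≠ i + 1 by omega]

theorem frameAvg_cosetT_apply (i j k : ℕ) (f : ℕ → Frame d A) :
    frameAvg d (cosetT d n t i) (cosetT d n t j) f k =
      frameAvg d (cosetDiag d n t i k) (cosetDiag d n t j k) * f k := by
  have h1 := algHom_frameAvg (d := d) (Algebra.lmul ℂ (ℕ → Frame d A)) (cosetDiag d n t i)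
    (cosetDiag d n t j)
  have h2 := algHom_frameAvg (d := d) (Pi.evalAlgHom ℂ (fun _ : ℕ => Frame d A) k)
    (cosetDiag d n t i) (cosetDiag d n t j)
  unfold cosetT
  rw [← h1]
  change frameAvg d (cosetDiag d n t i) (cosetDiag d n t j) k * f k = _
  congr 1

/-! ### The Yokonuma–Hecke relations on the coset module -/

theorem YHFamily.avg_const_comm (h : YHFamily d n q g t) {i j : ℕ} (hi : i + 1 < n) (hj : j < n)
    (h1 : j ≠ i) (h2 : j ≠ i + 1) :
    const d (g i) * frameAvg d (frameVar d) (const d (t j)) =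
      frameAvg d (frameVar d) (const d (t j)) * const d (g i) :=
  mul_frameAvg (frameVar_comm d _).symm.eq (by simp only [← map_mul, h.t_g_far i j hi hj h1 h2])

theorem YHFamily.avg_const_left (h : YHFamily d n q g t) {i : ℕ} (hi : i + 1 < n) :
    const d (g i) * frameAvg d (frameVar d) (const d (t i)) =
      frameAvg d (frameVar d) (const d (t (i + 1))) * const d (g i) :=
  mul_frameAvg (frameVar_comm d _).symm.eq (by simp only [← map_mul, h.t_g_right i hi])

theorem YHFamily.avg_const_right (h : YHFamily d n q g t) {i : ℕ} (hi : i + 1 < n) :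
    const d (g i) * frameAvg d (frameVar d) (const d (t (i + 1))) =
      frameAvg d (frameVar d) (const d (t i)) * const d (g i) :=
  mul_frameAvg (frameVar_comm d _).symm.eq (by simp only [← map_mul, h.t_g_left i hi])

theorem const_pow {a : A} (h : a ^ d = 1) : const d a ^ d = 1 := by rw [← map_pow, h, map_one]

theorem YHFamily.coset_braid (h : YHFamily d n q g t) (i : ℕ) (hi : i + 1 < n) :
    cosetG d n q g t i * cosetG d n q g t (i + 1) * cosetG d n q g t i =
      cosetG d n q g t (i + 1) * cosetG d n q g t i * cosetG d n q g t (i + 1) := by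
  refine LinearMap.ext fun f => funext fun k => ?_
  simp only [Module.End.mul_apply]
  have hl := h.avg_const_left hi
  have hr := h.avg_const_right hi
  rcases lt_or_ge n k with hn | hn
  · simp only [cosetG_out hn]
  rcases lt_trichotomy k i with hk | rfl | hk
  · obtain ⟨i, rfl⟩ : ∃ i', i = i' + 1 := ⟨i - 1, by omega⟩
    simp (disch := omega) only [cosetG_lt, Nat.add_sub_cancel]
    simp only [← mul_assoc, ← map_mul, h.braid i hi]
  · simp (disch := omega) only [cosetG_lt, cosetG_self, cosetG_succ, cosetG_gt,
      Nat.add_sub_cancel]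
    have hq : const d (g k) * const d (g k) = 1 + (q - q⁻¹) •
        (frameAvg d (const d (t k)) (const d (t (k + 1))) * const d (g k)) := by
      rw [← map_mul, h.quad k hi, map_add, map_one, map_smul, map_mul, algHom_frameAvg]
    -- With ε, ε' the averages of τ with t_k, t_{k+1}, and E that of t_k with t_{k+1}, this says ε'
    -- ε = E ε.
    have he := frameAvg_mul_eq (d := d) (u := const d (t k)) (v := frameVar d)
      (w := const d (t (k + 1))) (frameVar_comm d _).symm
      (by simp only [commute_iff_eq, ← map_mul, h.t_comm k (k + 1) (by omega) hi])
      (frameVar_comm d _) (const_pow (h.t_pow _ (by omega))) (frameVar_pow_self d)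
    rw [frameAvg_comm (frameVar_comm d _).symm (const_pow (h.t_pow _ (by omega)))
      (frameVar_pow_self d)] at he
    have hc : Commute (frameAvg d (frameVar d) (const d (t k)))
        (frameAvg d (frameVar d) (const d (t (k + 1)))) :=
      commute_frameAvg (frameVar_comm d _).symm (commute_frameAvg (frameVar_comm d _).symm
        (by simp only [commute_iff_eq, ← map_mul, h.t_comm (k + 1) k hi (by omega)])).symm
    generalize frameAvg d (frameVar d) (const d (t k)) = ε at *
    generalize frameAvg d (frameVar d) (const d (t (k + 1))) = ε' at *
    generalize frameAvg d (const d (t k)) (const d (t (k + 1))) = E at *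
    generalize const d (g k) = γ at *
    generalize q - q⁻¹ = c at *
    -- Sliding ε to the right gives γ² ε'. The quadratic relation produces the term E γ ε' = E ε γ,
    -- in which E ε becomes ε' ε.
    have h1 : γ * ε * γ = ε' + c • (ε * γ * ε) := by
      rw [mul_assoc, ← hr, ← mul_assoc, hq, add_mul, one_mul, smul_mul_assoc, mul_assoc, hr,
        ← mul_assoc, ← he, mul_assoc ε γ ε, hl, ← mul_assoc, hc.eq]
    simp only [mul_add, smul_add, mul_smul_comm, ← mul_assoc, h1, hr]
    simp only [add_mul, smul_add, smul_mul_assoc]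
    abel
  · rcases (show i + 1 ≤ k by omega).eq_or_lt with rfl | hk
    · simp (disch := omega) only [cosetG_lt, cosetG_self, cosetG_succ, cosetG_gt,
        Nat.add_sub_cancel, mul_add, mul_smul_comm, ← mul_assoc, hl]
    · rcases (show i + 1 + 1 ≤ k by omega).eq_or_lt with rfl | hk
      · simp (disch := omega) only [cosetG_lt, cosetG_succ, cosetG_gt, Nat.add_sub_cancel]
      · simp (disch := omega) only [cosetG_gt]
        simp only [← mul_assoc, ← map_mul, h.braid i (by omega)]

theorem YHFamily.coset_far (h : YHFamily d n q g t) (i j : ℕ) (hij : i + 1 < j) (hj : j < n) :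
    cosetG d n q g t i * cosetG d n q g t j = cosetG d n q g t j * cosetG d n q g t i := by
  refine LinearMap.ext fun f => funext fun k => ?_
  simp only [Module.End.mul_apply]
  rcases lt_or_ge n k with hn | hn
  · simp only [cosetG_out hn]
  obtain ⟨j, rfl⟩ : ∃ j', j = j' + 1 := ⟨j - 1, by omega⟩
  rcases lt_trichotomy k i with hk | rfl | hk
  · obtain ⟨i, rfl⟩ : ∃ i', i = i' + 1 := ⟨i - 1, by omega⟩
    simp (disch := omega) only [cosetG_lt, Nat.add_sub_cancel]
    simp only [← mul_assoc, ← map_mul, h.far i j (by omega) (by omega)]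
  · simp (disch := omega) only [cosetG_lt, cosetG_self, Nat.add_sub_cancel, mul_add,
      mul_smul_comm, ← mul_assoc, h.avg_const_comm (i := j) (j := k) (by omega) (by omega)
      (by omega) (by omega)]
  rcases (show i + 1 ≤ k by omega).eq_or_lt with rfl | hk
  · simp (disch := omega) only [cosetG_lt, cosetG_succ, Nat.add_sub_cancel]
  rcases lt_trichotomy k (j + 1) with hk' | rfl | hk'
  · simp (disch := omega) only [cosetG_lt, cosetG_gt, Nat.add_sub_cancel]
    simp only [← mul_assoc, ← map_mul, h.far i j (by omega) (by omega)]
  · simp (disch := omega) only [cosetG_gt, cosetG_self, mul_add,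
      mul_smul_comm, ← mul_assoc, h.avg_const_comm (i := i) (j := j + 1) (by omega) (by omega)
      (by omega) (by omega)]
  rcases (show j + 1 + 1 ≤ k by omega).eq_or_lt with rfl | hk'
  · simp (disch := omega) only [cosetG_gt, cosetG_succ]
  · simp (disch := omega) only [cosetG_gt]
    simp only [← mul_assoc, ← map_mul, h.far i (j + 1) (by omega) (by omega)]

theorem cosetDiag_cases {j : ℕ} (hj : j ≤ n) (k : ℕ) : cosetDiag d n t j k = 1 ∨
    cosetDiag d n t j k = frameVar d ∨ ∃ m < n, cosetDiag d n t j k = const d (t m) := by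
  rcases lt_or_ge n k with hn | hn
  · exact Or.inl (cosetDiag_out hn)
  rcases lt_trichotomy k j with hk | rfl | hk
  · exact Or.inr (Or.inr ⟨j - 1, by omega, cosetDiag_gt hn hk⟩)
  · exact Or.inr (Or.inl (cosetDiag_self hj))
  · exact Or.inr (Or.inr ⟨j, by omega, cosetDiag_lt hn hk⟩)

theorem YHFamily.cosetDiag_comm (h : YHFamily d n q g t) {i j : ℕ} (hi : i ≤ n) (hj : j ≤ n)
    (k : ℕ) : Commute (cosetDiag d n t i k) (cosetDiag d n t j k) := by
  rcases cosetDiag_cases (d := d) (t := t) hi k with h1 | h1 | ⟨m, hm, h1⟩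
  · rw [h1]; exact Commute.one_left _
  · rw [h1]; exact frameVar_comm d _
  rcases cosetDiag_cases (d := d) (t := t) hj k with h2 | h2 | ⟨m', hm', h2⟩
  · rw [h2]; exact Commute.one_right _
  · rw [h2]; exact (frameVar_comm d _).symm
  · rw [h1, h2, commute_iff_eq, ← map_mul, ← map_mul, h.t_comm m m' hm hm']

theorem YHFamily.cosetDiag_pow (h : YHFamily d n q g t) {j : ℕ} (hj : j ≤ n) (k : ℕ) :
    cosetDiag d n t j k ^ d = 1 := by
  rcases cosetDiag_cases (d := d) (t := t) hj k with h1 | h1 | ⟨m, hm, h1⟩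
  · rw [h1, one_pow]
  · rw [h1, frameVar_pow_self]
  · rw [h1, const_pow (h.t_pow m hm)]

theorem YHFamily.coset_t_g_left (h : YHFamily d n q g t) (i : ℕ) (hi : i < n) :
    cosetT d n t i * cosetG d n q g t i = cosetG d n q g t i * cosetT d n t (i + 1) := by
  refine LinearMap.ext fun f => funext fun k => ?_
  simp only [Module.End.mul_apply, cosetT_apply]
  rcases lt_or_ge n k with hn | hn
  · simp only [cosetG_out hn, cosetDiag_out hn, cosetT_apply, one_mul]
  rcases lt_trichotomy k i with hk | rfl | hk
  · obtain ⟨i, rfl⟩ : ∃ i', i = i' + 1 := ⟨i - 1, by omega⟩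
    simp (disch := omega) only [cosetG_lt, cosetDiag_gt, cosetT_apply, Nat.add_sub_cancel]
    simp only [← mul_assoc, ← map_mul, h.t_g_left i hi]
  · have ha := mul_frameAvg_absorb (d := d) (frameVar_comm d (const d (t k)))
      (frameVar_pow_self d) (const_pow (h.t_pow k hi))
    have hc := commute_frameAvg (d := d) (x := const d (t k)) (frameVar_comm d _).symm
      (Commute.refl (const d (t k)))
    simp (disch := omega) only [cosetG_self, cosetDiag_self, cosetDiag_gt, cosetT_apply,
      Nat.add_sub_cancel]
    rw [mul_add, mul_smul_comm, ← mul_assoc, ha, hc.eq, mul_assoc]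
  rcases (show i + 1 ≤ k by omega).eq_or_lt with rfl | hk
  · simp (disch := omega) only [cosetG_succ, cosetDiag_lt, cosetT_apply, cosetDiag_gt,
      Nat.add_sub_cancel]
  · simp (disch := omega) only [cosetG_gt, cosetDiag_lt, cosetT_apply]
    simp only [← mul_assoc, ← map_mul, h.t_g_left i (by omega)]

theorem YHFamily.coset_t_g_right (h : YHFamily d n q g t) (i : ℕ) (hi : i < n) :
    cosetT d n t (i + 1) * cosetG d n q g t i = cosetG d n q g t i * cosetT d n t i := by
  refine LinearMap.ext fun f => funext fun k => ?_
  simp only [Module.End.mul_apply, cosetT_apply]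
  rcases lt_or_ge n k with hn | hn
  · simp only [cosetG_out hn, cosetDiag_out hn, cosetT_apply, one_mul]
  rcases lt_trichotomy k i with hk | rfl | hk
  · obtain ⟨i, rfl⟩ : ∃ i', i = i' + 1 := ⟨i - 1, by omega⟩
    simp (disch := omega) only [cosetG_lt, cosetDiag_gt, cosetT_apply, Nat.add_sub_cancel]
    simp only [← mul_assoc, ← map_mul, h.t_g_right i hi]
  · have ha := mul_frameAvg_absorb (d := d) (frameVar_comm d (const d (t k)))
      (frameVar_pow_self d) (const_pow (h.t_pow k hi))
    simp (disch := omega) only [cosetG_self, cosetDiag_self, cosetDiag_gt, cosetDiag_lt,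
      cosetT_apply, Nat.add_sub_cancel]
    rw [mul_add, mul_smul_comm, ← mul_assoc, ← ha, (frameVar_comm d _).eq, mul_assoc]
  rcases (show i + 1 ≤ k by omega).eq_or_lt with rfl | hk
  · simp (disch := omega) only [cosetG_succ, cosetDiag_self, cosetT_apply]
  · simp (disch := omega) only [cosetG_gt, cosetDiag_lt, cosetT_apply]
    simp only [← mul_assoc, ← map_mul, h.t_g_right i (by omega)]

theorem YHFamily.coset_t_g_far (h : YHFamily d n q g t) (i j : ℕ) (hi : i < n) (hj : j ≤ n)
    (h1 : j ≠ i) (h2 : j ≠ i + 1) :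
    cosetT d n t j * cosetG d n q g t i = cosetG d n q g t i * cosetT d n t j := by
  have hconst (i j : ℕ) (hi : i + 1 < n) (hj : j < n) (h1 : j ≠ i) (h2 : j ≠ i + 1) :
      const d (t j) * const d (g i) = const d (g i) * const d (t j) := by
    simp only [← map_mul, h.t_g_far i j hi hj h1 h2]
  have hε (m : ℕ) (hm : m < n) : const d (t m) * frameAvg d (frameVar d) (const d (t i)) =
      frameAvg d (frameVar d) (const d (t i)) * const d (t m) :=
    commute_frameAvg (frameVar_comm d _).symm
      (by simp only [commute_iff_eq, ← map_mul, h.t_comm m i hm hi])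
  refine LinearMap.ext fun f => funext fun k => ?_
  simp only [Module.End.mul_apply, cosetT_apply]
  rcases lt_or_ge n k with hn | hn
  · simp only [cosetG_out hn, cosetDiag_out hn, cosetT_apply, one_mul]
  rcases lt_trichotomy k i with hk | rfl | hk
  · simp (disch := omega) only [cosetG_lt, cosetT_apply]
    rcases lt_trichotomy k j with hkj | rfl | hkj
    · simp (disch := omega) only [cosetDiag_gt, ← mul_assoc, hconst]
    · simp only [cosetDiag_self hn, ← mul_assoc, (frameVar_comm d _).eq]
    · simp (disch := omega) only [cosetDiag_lt, ← mul_assoc, hconst]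
  · simp (disch := omega) only [cosetG_self, cosetT_apply]
    rcases lt_or_gt_of_ne h1 with hkj | hkj
    · simp (disch := omega) only [cosetDiag_lt, mul_add, mul_smul_comm, ← mul_assoc, hε]
    · simp (disch := omega) only [cosetDiag_gt, mul_add, mul_smul_comm, ← mul_assoc, hε]
  rcases (show i + 1 ≤ k by omega).eq_or_lt with rfl | hk
  · simp (disch := omega) only [cosetG_succ, cosetT_apply]
    rcases lt_or_gt_of_ne h1 with hkj | hkj
    · simp (disch := omega) only [cosetDiag_lt]
    · simp (disch := omega) only [cosetDiag_gt]
  · simp (disch := omega) only [cosetG_gt, cosetT_apply]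
    rcases lt_trichotomy k j with hkj | rfl | hkj
    · simp (disch := omega) only [cosetDiag_gt, ← mul_assoc, hconst]
    · simp only [cosetDiag_self hn, ← mul_assoc, (frameVar_comm d _).eq]
    · simp (disch := omega) only [cosetDiag_lt, ← mul_assoc, hconst]

theorem YHFamily.coset_quad (h : YHFamily d n q g t) (hd : 1 ≤ d) (hq : q ≠ 0) (i : ℕ)
    (hi : i < n) :
    cosetG d n q g t i * cosetG d n q g t i = 1 + (q - q⁻¹) •
      (frameAvg d (cosetT d n t i) (cosetT d n t (i + 1)) * cosetG d n q g t i) := by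
  refine LinearMap.ext fun f => funext fun k => ?_
  simp only [Module.End.mul_apply, LinearMap.add_apply, Module.End.one_apply,
    LinearMap.smul_apply, Pi.add_apply, Pi.smul_apply, frameAvg_cosetT_apply]
  have hconst (j : ℕ) (hj : j + 1 < n) : const d (g j) * const d (g j) = 1 + (q - q⁻¹) •
      (frameAvg d (const d (t j)) (const d (t (j + 1))) * const d (g j)) := by
    rw [← map_mul, h.quad j hj, map_add, map_one, map_smul, map_mul, algHom_frameAvg]
  rcases lt_or_ge n k with hn | hn
  · have h1 : frameAvg d (1 : Frame d A) 1 = 1 := by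
      simp only [frameAvg, one_pow, mul_one, Finset.sum_const, Finset.card_range]
      rw [← Nat.cast_smul_eq_nsmul ℂ, smul_smul, inv_mul_cancel₀ (by exact_mod_cast (by omega)),
        one_smul]
    simp only [cosetG_out hn, cosetDiag_out hn, h1, one_mul, smul_smul]
    nth_rewrite 2 [← one_smul ℂ (f k)]
    rw [← add_smul, sub_mul, inv_mul_cancel₀ hq]
    congr 1
    ring
  rcases lt_trichotomy k i with hk | rfl | hk
  · obtain ⟨i, rfl⟩ : ∃ i', i = i' + 1 := ⟨i - 1, by omega⟩
    simp (disch := omega) only [cosetG_lt, cosetDiag_gt, Nat.add_sub_cancel]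
    rw [← mul_assoc, hconst i hi, add_mul, one_mul, smul_mul_assoc, mul_assoc]
  · simp (disch := omega) only [cosetDiag_self, cosetDiag_gt, Nat.add_sub_cancel]
    rw [cosetG_self hn, cosetG_succ (by omega)]
  rcases (show i + 1 ≤ k by omega).eq_or_lt with rfl | hk
  · simp (disch := omega) only [cosetDiag_self, cosetDiag_lt, cosetG_succ, cosetG_self]
    rw [frameAvg_comm (frameVar_comm d _) (frameVar_pow_self d) (const_pow (h.t_pow i hi))]
  · simp (disch := omega) only [cosetG_gt, cosetDiag_lt]
    rw [← mul_assoc, hconst i (by omega), add_mul, one_mul, smul_mul_assoc, mul_assoc]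

/-- The inductive step that stands in for a basis theorem: a family on n strands yields one on n + 1
strands, hence an action of Y_{n+1} on the model. -/
theorem YHFamily.coset (h : YHFamily d n q g t) (hd : 1 ≤ d) (hq : q ≠ 0) :
    YHFamily d (n + 1) q (cosetG d n q g t) (cosetT d n t) where
  braid i hi := h.coset_braid i (by omega)
  far i j hij hj := h.coset_far i j hij (by omega)
  t_comm i j hi hj := by
    refine LinearMap.ext fun f => funext fun k => ?_
    simp only [Module.End.mul_apply, cosetT_apply, ← mul_assoc,
      (h.cosetDiag_comm (Nat.lt_succ_iff.1 hi) (Nat.lt_succ_iff.1 hj) k).eq]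
  t_g_left i hi := h.coset_t_g_left i (by omega)
  t_g_right i hi := h.coset_t_g_right i (by omega)
  t_g_far i j hi hj h1 h2 := h.coset_t_g_far i j (by omega) (by omega) h1 h2
  t_pow j hj := by
    rw [cosetT, ← map_pow, show cosetDiag d n t j ^ d = 1 from
      funext fun k => h.cosetDiag_pow (Nat.lt_succ_iff.1 hj) k, map_one]
  quad i hi := h.coset_quad hd hq i (by omega)

end coset

/-! ### The two bimodule projections of the coset module -/

/-- The product `g k * g (k + 1) * ⋯ * g (k + m - 1)`. -/
def tailProd {A : Type} [Ring A] (g : ℕ → A) : ℕ → ℕ → A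
  | _, 0 => 1
  | k, m + 1 => g k * tailProd g (k + 1) m

section tail

variable {d n : ℕ} {q : ℂ} {A : Type} [Ring A] [Algebra ℂ A] {g t : ℕ → A}

/-- The tail carries one strand across the m following ones. Its framing travels to the far end, the
framings it passes shift by one place, and those below the tail are unaffected; the next two lemmas
are these other cases. -/
theorem YHFamily.t_tail_self (h : YHFamily d n q g t) {k m : ℕ} (hk : k + m < n) :
    t k * tailProd g k m = tailProd g k m * t (k + m) := by
  induction m generalizing k with
  | zero => simp [tailProd]
  | succ m ih =>
    rw [tailProd, ← mul_assoc, h.t_g_left k (by omega), mul_assoc, ih (by omega), mul_assoc,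
      show k + 1 + m = k + (m + 1) by omega]

theorem YHFamily.t_tail_lt (h : YHFamily d n q g t) {j k m : ℕ} (hk : k + m < n) (hj : j < k) :
    t j * tailProd g k m = tailProd g k m * t j := by
  induction m generalizing k with
  | zero => simp [tailProd]
  | succ m ih =>
    rw [tailProd, ← mul_assoc, h.t_g_far k j (by omega) (by omega) (by omega) (by omega),
      mul_assoc, ih (by omega) (by omega), mul_assoc]

theorem YHFamily.t_tail_gt (h : YHFamily d n q g t) {j k m : ℕ} (hk : k + m < n) (hj : k ≤ j)
    (hj' : j < k + m) : t (j + 1) * tailProd g k m = tailProd g k m * t j := by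
  induction m generalizing k with
  | zero => omega
  | succ m ih =>
    rw [tailProd, ← mul_assoc]
    rcases hj.eq_or_lt with rfl | hj
    · rw [h.t_g_right k (by omega), mul_assoc, h.t_tail_lt (by omega) (by omega), mul_assoc]
    · rw [h.t_g_far k (j + 1) (by omega) (by omega) (by omega) (by omega), mul_assoc,
        ih (by omega) (by omega) (by omega), mul_assoc]

theorem YHFamily.g_tail_lt (h : YHFamily d n q g t) {i k m : ℕ} (hk : k + m < n)
    (hi : i + 1 < k) : g i * tailProd g k m = tailProd g k m * g i := by
  induction m generalizing k with
  | zero => simp [tailProd]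
  | succ m ih =>
    rw [tailProd, ← mul_assoc, h.far i k hi (by omega), mul_assoc, ih (by omega) (by omega),
      mul_assoc]

/-- At the place where the crossing meets the tail, the braid relation lowers its index by one; it
then commutes with the rest. -/
theorem YHFamily.g_tail_gt (h : YHFamily d n q g t) {i k m : ℕ} (hk : k + m < n) (hi : k ≤ i)
    (hi' : i + 1 < k + m) : g (i + 1) * tailProd g k m = tailProd g k m * g i := by
  induction m generalizing k with
  | zero => omega
  | succ m ih =>
    rcases hi.eq_or_lt with rfl | hi
    · obtain ⟨m, rfl⟩ : ∃ m', m = m' + 1 := ⟨m - 1, by omega⟩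
      simp only [tailProd]
      rw [← mul_assoc, ← mul_assoc, ← h.braid k (by omega), mul_assoc,
        h.g_tail_lt (by omega) (by omega)]
      simp only [mul_assoc]
    · rw [tailProd, ← mul_assoc, ← h.far k (i + 1) (by omega) (by omega), mul_assoc,
        ih (by omega) (by omega) (by omega), mul_assoc]

/-! ### Evaluation of τ and removal of the last crossing -/

variable (d) in
/-- The evaluation of `∑ s, τ ^ s * a s` at `τ = x`, with `x` on the left. -/
def frameEval (x : A) : Frame d A →ₗ[ℂ] A :=
  (Finsupp.lsum ℂ fun k : ZMod d => LinearMap.mulLeft ℂ (x ^ k.val)) ∘ₗ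
    (AddMonoidAlgebra.coeffLinearEquiv ℂ).toLinearMap

theorem frameEval_single (x : A) (k : ZMod d) (a : A) :
    frameEval d x (AddMonoidAlgebra.single k a) = x ^ k.val * a := by
  simp [frameEval]

theorem frameEval_one (x : A) : frameEval d x 1 = 1 := by
  rw [AddMonoidAlgebra.one_def, frameEval_single, ZMod.val_zero, pow_zero, one_mul]

/-- Powers of x are written on the left of the coefficients, so a left factor has to commute with x;
a right factor needs no condition. -/
theorem frameEval_const_mul {x a : A} (h : Commute a x) (b : Frame d A) :
    frameEval d x (const d a * b) = a * frameEval d x b := by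
  induction b using AddMonoidAlgebra.induction_linear with
  | zero => simp
  | add b b' hb hb' => rw [mul_add, map_add, map_add, mul_add, hb, hb']
  | single k c =>
    simp only [const, AddMonoidAlgebra.singleZeroAlgHom_apply, AddMonoidAlgebra.single_mul_single,
      frameEval_single, zero_add, ← mul_assoc, (h.pow_right k.val).eq]

theorem frameEval_mul_const (x a : A) (b : Frame d A) :
    frameEval d x (b * const d a) = frameEval d x b * a := by
  induction b using AddMonoidAlgebra.induction_linear with
  | zero => simp
  | add b b' hb hb' => rw [add_mul, map_add, map_add, add_mul, hb, hb']
  | single k c =>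
    simp only [const, AddMonoidAlgebra.singleZeroAlgHom_apply, AddMonoidAlgebra.single_mul_single,
      frameEval_single, add_zero, ← mul_assoc]

theorem frameEval_var_mul (hd : 1 ≤ d) {x : A} (h : x ^ d = 1) (b : Frame d A) :
    frameEval d x (frameVar d * b) = x * frameEval d x b := by
  have : NeZero d := ⟨by omega⟩
  induction b using AddMonoidAlgebra.induction_linear with
  | zero => simp
  | add b b' hb hb' => rw [mul_add, map_add, map_add, mul_add, hb, hb']
  | single k c =>
    -- Exponents are representatives modulo d, and x^d = 1 makes the reduction harmless. The
    -- representative of 1 is 1 mod d, which is 0 when d = 1.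
    rw [frameVar, AddMonoidAlgebra.single_mul_single, frameEval_single, frameEval_single, one_mul,
      ← mul_assoc, ← pow_succ', ZMod.val_add, ← pow_eq_pow_mod _ h, ZMod.val_one_eq_one_mod,
      pow_add, ← pow_eq_pow_mod _ h, ← pow_add, add_comm]

variable (d n g t) in
/-- The map `∑ₖ mₖ fₖ ↦ ∑_{k<n} g k ⋯ g (n - 2) fₖ(t (n - 1))` on the coset module. -/
def cosetTheta : (ℕ → Frame d A) →ₗ[ℂ] A :=
  ∑ k ∈ Finset.range n, LinearMap.mulLeft ℂ (tailProd g k (n - 1 - k)) ∘ₗ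
    frameEval d (t (n - 1)) ∘ₗ LinearMap.proj k

theorem cosetTheta_apply (f : ℕ → Frame d A) : cosetTheta d n g t f =
    ∑ k ∈ Finset.range n, tailProd g k (n - 1 - k) * frameEval d (t (n - 1)) (f k) := by
  simp [cosetTheta]

theorem cosetTheta_mul_const (f : ℕ → Frame d A) (a : A) :
    cosetTheta d n g t (f * fun _ => const d a) = cosetTheta d n g t f * a := by
  simp only [cosetTheta_apply, Pi.mul_apply, frameEval_mul_const, Finset.sum_mul, mul_assoc]

/-- In the algebra m_k τ^s = g_k ⋯ g_{n-2} t_{n-1}^s g_{n-1} for k < n, and `cosetTheta` deletes the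
final g_{n-1}. Linearity over the framings is the way they slide through the tail. -/
theorem YHFamily.cosetTheta_cosetT (h : YHFamily d n q g t) (hd : 1 ≤ d) {j : ℕ} (hj : j < n)
    (f : ℕ → Frame d A) :
    cosetTheta d n g t (cosetT d n t j f) = t j * cosetTheta d n g t f := by
  simp only [cosetTheta_apply, cosetT_apply, Finset.mul_sum]
  refine Finset.sum_congr rfl fun k hk => ?_
  have hk := Finset.mem_range.1 hk
  have hc (i : ℕ) (hi : i < n) : Commute (t i) (t (n - 1)) := h.t_comm _ _ hi (by omega)
  rw [← mul_assoc]
  rcases lt_trichotomy k j with hkj | rfl | hkj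
  · obtain ⟨j, rfl⟩ : ∃ j', j = j' + 1 := ⟨j - 1, by omega⟩
    rw [cosetDiag_gt (by omega) hkj, frameEval_const_mul (hc _ (by omega)), ← mul_assoc,
      h.t_tail_gt (by omega) (by omega) (by omega), Nat.add_sub_cancel]
  · rw [cosetDiag_self (by omega), frameEval_var_mul hd (h.t_pow _ (by omega)), ← mul_assoc,
      h.t_tail_self (by omega), show k + (n - 1 - k) = n - 1 by omega]
  · rw [cosetDiag_lt (by omega) hkj, frameEval_const_mul (hc _ (by omega)), ← mul_assoc,
      h.t_tail_lt (by omega) hkj]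

theorem sum_range_eq_of_pair {M : Type} [AddCommGroup M] {n i : ℕ} (hi : i + 1 < n) {x y : ℕ → M}
    (h : ∀ k < n, k ≠ i → k ≠ i + 1 → x k = y k) (h' : x i + x (i + 1) = y i + y (i + 1)) :
    ∑ k ∈ Finset.range n, x k = ∑ k ∈ Finset.range n, y k := by
  have hs : ({i, i + 1} : Finset ℕ) ⊆ Finset.range n := by
    intro k hk
    simp only [Finset.mem_insert, Finset.mem_singleton, Finset.mem_range] at hk ⊢
    omega
  rw [← Finset.sum_sdiff hs, ← Finset.sum_sdiff hs, Finset.sum_pair (by omega),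
    Finset.sum_pair (by omega), h']
  congr 1
  refine Finset.sum_congr rfl fun k hk => ?_
  simp only [Finset.mem_sdiff, Finset.mem_insert, Finset.mem_singleton, Finset.mem_range,
    not_or] at hk
  exact h k hk.1 hk.2.1 hk.2.2

/-- Only the summands i and i + 1 are mixed by g_i, and they recombine by the quadratic relation.
All others match one by one. -/
theorem YHFamily.cosetTheta_cosetG (h : YHFamily d n q g t) (hd : 1 ≤ d) {i : ℕ} (hi : i + 1 < n)
    (f : ℕ → Frame d A) :
    cosetTheta d n g t (cosetG d n q g t i f) = g i * cosetTheta d n g t f := by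
  simp only [cosetTheta_apply, Finset.mul_sum]
  refine sum_range_eq_of_pair hi (fun k hk h1 h2 => ?_) ?_
  · have hc (i : ℕ) (hi : i + 1 < n - 1) : Commute (g i) (t (n - 1)) :=
      (h.t_g_far i (n - 1) (by omega) (by omega) (by omega) (by omega)).symm
    rw [← mul_assoc]
    rcases lt_or_gt_of_ne h1 with hki | hki
    · obtain ⟨i, rfl⟩ : ∃ i', i = i' + 1 := ⟨i - 1, by omega⟩
      rw [cosetG_lt (by omega) hki, Nat.add_sub_cancel, frameEval_const_mul (hc _ (by omega)),
        ← mul_assoc, h.g_tail_gt (by omega) (by omega) (by omega)]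
    · rw [cosetG_gt (by omega) (by omega), frameEval_const_mul (hc _ (by omega)),
        ← mul_assoc, h.g_tail_lt (by omega) (by omega)]
  · have htail : tailProd g i (n - 1 - i) = g i * tailProd g (i + 1) (n - 1 - (i + 1)) := by
      rw [show n - 1 - i = n - 1 - (i + 1) + 1 by omega, tailProd]
    have hε : frameEval d (t (n - 1)) (frameAvg d (frameVar d) (const d (t i)) * f i) =
        frameAvg d (t (n - 1)) (t i) * frameEval d (t (n - 1)) (f i) :=
      linearMap_frameAvg_mul _ (frameEval_var_mul hd (h.t_pow _ (by omega)))
        (frameEval_const_mul (h.t_comm _ _ (by omega) (by omega))) _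
    have hP : tailProd g i (n - 1 - i) * frameAvg d (t (n - 1)) (t i) =
        frameAvg d (t i) (t (i + 1)) * tailProd g i (n - 1 - i) := by
      refine mul_frameAvg ?_ (h.t_tail_gt (by omega) le_rfl (by omega)).symm
      rw [h.t_tail_self (by omega), show i + (n - 1 - i) = n - 1 by omega]
    have hgP : g i * tailProd g i (n - 1 - i) = tailProd g (i + 1) (n - 1 - (i + 1)) +
        (q - q⁻¹) • (frameAvg d (t i) (t (i + 1)) * tailProd g i (n - 1 - i)) := by
      rw [htail, ← mul_assoc, h.quad i hi, add_mul, one_mul, smul_mul_assoc, mul_assoc]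
    rw [cosetG_self (by omega), cosetG_succ (by omega), map_add, map_smul, hε, mul_add,
      mul_smul_comm, ← mul_assoc, ← mul_assoc, ← mul_assoc, hP, hgP, ← htail, add_mul,
      smul_mul_assoc]
    abel

/-! ### Coefficients of the last coordinate -/

variable (d n) in
/-- The coefficient of `τ ^ s` of the last coordinate of an element of the coset module. -/
def cosetCoeff (s : ZMod d) : (ℕ → Frame d A) →ₗ[ℂ] A :=
  Finsupp.lapply s ∘ₗ (AddMonoidAlgebra.coeffLinearEquiv ℂ).toLinearMap ∘ₗ LinearMap.proj n

theorem cosetCoeff_apply (s : ZMod d) (f : ℕ → Frame d A) :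
    cosetCoeff d n s f = (f n).coeff s := rfl

theorem coeff_const_mul (a : A) (b : Frame d A) (s : ZMod d) :
    (const d a * b).coeff s = a * b.coeff s :=
  AddMonoidAlgebra.coeff_single_zero_mul b a s

theorem coeff_mul_const (a : A) (b : Frame d A) (s : ZMod d) :
    (b * const d a).coeff s = b.coeff s * a :=
  AddMonoidAlgebra.coeff_mul_single_zero b a s

theorem cosetCoeff_mul_const (s : ZMod d) (f : ℕ → Frame d A) (a : A) :
    cosetCoeff d n s (f * fun _ => const d a) = cosetCoeff d n s f * a :=
  coeff_mul_const a (f n) s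

theorem cosetCoeff_cosetT (s : ZMod d) {j : ℕ} (hj : j < n) (f : ℕ → Frame d A) :
    cosetCoeff d n s (cosetT d n t j f) = t j * cosetCoeff d n s f := by
  rw [cosetCoeff_apply, cosetT_apply, cosetDiag_lt le_rfl hj, coeff_const_mul]
  rfl

theorem cosetCoeff_cosetG (s : ZMod d) {i : ℕ} (hi : i + 1 < n) (f : ℕ → Frame d A) :
    cosetCoeff d n s (cosetG d n q g t i f) = g i * cosetCoeff d n s f := by
  rw [cosetCoeff_apply, cosetG_gt le_rfl hi, coeff_const_mul]
  rfl

theorem cosetT_mul_const (j : ℕ) (f : ℕ → Frame d A) (a : A) :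
    cosetT d n t j (f * fun _ => const d a) = cosetT d n t j f * fun _ => const d a :=
  (mul_assoc _ _ _).symm

theorem cosetG_mul_const (i : ℕ) (f : ℕ → Frame d A) (a : A) :
    cosetG d n q g t i (f * fun _ => const d a) = cosetG d n q g t i f * fun _ => const d a := by
  funext k
  simp only [cosetG, LinearMap.coe_mk, AddHom.coe_mk, Pi.mul_apply]
  split_ifs <;> simp only [add_mul, smul_mul_assoc, mul_assoc]

end tail

/-! ### The conditional expectations -/

/-- Induction on the elements of `Y_{d,n}(q)`. -/
theorem YH_induction {d n : ℕ} {q : ℂ} (hd : 1 ≤ d) {p : YH d n q → Prop}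
    (hG : ∀ i, i + 1 < n → p (G d n q i)) (hT : ∀ j, j < n → p (T d n q j))
    (hc : ∀ c : ℂ, p (algebraMap ℂ _ c)) (hadd : ∀ a b, p a → p b → p (a + b))
    (hmul : ∀ a b, p a → p b → p (a * b)) (a : YH d n q) : p a := by
  let S : Subalgebra ℂ (YH d n q) :=
    { carrier := {a | p a}
      mul_mem' := fun {a b} ha hb => hmul a b ha hb
      add_mem' := fun {a b} ha hb => hadd a b ha hb
      algebraMap_mem' := hc }
  have : a ∈ S := (eq_top_of_generators hd S hG hT) ▸ Algebra.mem_top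
  exact this

section condExp

variable {d : ℕ} (hd : 1 ≤ d) (n : ℕ) {q : ℂ} (hq : q ≠ 0)

/-- The representation of `Y_{d,n+1}(q)` on the coset module with coefficients in
`Y_{d,n}(q)`. -/
def cosetRep : YH d (n + 1) q →ₐ[ℂ] Module.End ℂ (ℕ → Frame d (YH d n q)) :=
  ((yhFamily d n q).coset hd hq).lift hd

/-- The generator of the coset module. -/
def cosetVec : ℕ → Frame d (YH d n q) := Pi.single n 1

theorem cosetRep_G {i : ℕ} (hi : i < n) :
    cosetRep hd n hq (G d (n + 1) q i) = cosetG d n q (G d n q) (T d n q) i :=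
  YHFamily.lift_G _ hd (by omega)

theorem cosetRep_T {j : ℕ} (hj : j ≤ n) :
    cosetRep hd n hq (T d (n + 1) q j) = cosetT d n (T d n q) j :=
  YHFamily.lift_T _ hd (by omega)

theorem cosetRep_mul_const (y : YH d (n + 1) q) (f : ℕ → Frame d (YH d n q)) (a : YH d n q) :
    cosetRep hd n hq y (f * fun _ => const d a) = cosetRep hd n hq y f * fun _ => const d a := by
  induction y using YH_induction hd generalizing f with
  | hG i hi => rw [cosetRep_G hd n hq (by omega), cosetG_mul_const]
  | hT j hj => rw [cosetRep_T hd n hq (by omega), cosetT_mul_const]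
  | hc c => simp [Module.algebraMap_end_apply]
  | hadd x y hx hy => simp only [map_add, LinearMap.add_apply, hx, hy, add_mul]
  | hmul x y hx hy => simp only [map_mul, Module.End.mul_apply, hx, hy]

/-- The vector stands for 1, on which left and right multiplication by Y_n agree. Together with
`cosetRep_mul_const` this makes `condExp` and `braidExp` right Y_n-linear. -/
theorem cosetRep_incl_vec (a : YH d n q) : cosetRep hd n hq (incl d n q a) (cosetVec n) =
    cosetVec n * fun _ => const d a := by
  induction a using YH_induction hd with
  | hG i hi =>
    rw [incl_G d n q hi, cosetRep_G hd n hq (by omega)]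
    funext k
    rcases lt_trichotomy k n with hk | rfl | hk
    · have h0 (k : ℕ) (hk : k < n) : (cosetVec n : ℕ → Frame d (YH d n q)) k = 0 :=
        Pi.single_eq_of_ne hk.ne _
      simp only [cosetG, LinearMap.coe_mk, AddHom.coe_mk, Pi.mul_apply, h0 k hk]
      split_ifs with h1 h2 h3 h4
      · simp
      · simp
      · rw [h0 (i + 1) (by omega), h0 i (by omega)]; simp
      · rw [h0 _ (by omega)]; simp
      · simp
    · rw [cosetG_gt le_rfl hi]
      simp [cosetVec]
    · rw [cosetG_out hk]
      simp [cosetVec, hk.ne']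
  | hT j hj =>
    rw [incl_T d n q hj, cosetRep_T hd n hq (by omega)]
    funext k
    rw [cosetT_apply, Pi.mul_apply]
    rcases eq_or_ne k n with rfl | hk
    · rw [cosetDiag_lt le_rfl hj]
      simp [cosetVec]
    · simp [cosetVec, hk]
  | hc c =>
    funext k
    rw [AlgHom.commutes, AlgHom.commutes, Module.algebraMap_end_apply, Pi.smul_apply,
      Pi.mul_apply, AlgHom.commutes, Algebra.smul_def, Algebra.commutes]
  | hadd x y hx hy =>
    funext k
    simp only [map_add, LinearMap.add_apply, hx, hy, Pi.mul_apply, Pi.add_apply, mul_add]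
  | hmul x y hx hy =>
    rw [map_mul, map_mul, Module.End.mul_apply, hy, cosetRep_mul_const, hx]
    funext k
    simp only [Pi.mul_apply, map_mul, mul_assoc]

/-- The bimodule map `Y_{d,n+1}(q) → Y_{d,n}(q)` with `t_{n+1}^s ↦ 1`, `t_{n+1}^r ↦ 0` for
`r ≠ s` and `g_n ↦ 0`. -/
def condExp (s : ZMod d) : YH d (n + 1) q →ₗ[ℂ] YH d n q :=
  cosetCoeff d n s ∘ₗ LinearMap.applyₗ (cosetVec n) ∘ₗ (cosetRep hd n hq).toLinearMap

/-- The bimodule map `Y_{d,n+1}(q) → Y_{d,n}(q)` with `t_{n+1}^s ↦ 0` and `g_n ↦ 1`. -/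
def braidExp : YH d (n + 1) q →ₗ[ℂ] YH d n q :=
  cosetTheta d n (G d n q) (T d n q) ∘ₗ LinearMap.applyₗ (cosetVec n) ∘ₗ
    (cosetRep hd n hq).toLinearMap

theorem condExp_apply (s : ZMod d) (y : YH d (n + 1) q) :
    condExp hd n hq s y = cosetCoeff d n s (cosetRep hd n hq y (cosetVec n)) := rfl

theorem braidExp_apply (y : YH d (n + 1) q) : braidExp hd n hq y =
    cosetTheta d n (G d n q) (T d n q) (cosetRep hd n hq y (cosetVec n)) := rfl

theorem condExp_mul_incl (s : ZMod d) (y : YH d (n + 1) q) (a : YH d n q) :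
    condExp hd n hq s (y * incl d n q a) = condExp hd n hq s y * a := by
  rw [condExp_apply, map_mul, Module.End.mul_apply, cosetRep_incl_vec, cosetRep_mul_const,
    cosetCoeff_mul_const, condExp_apply]

theorem braidExp_mul_incl (y : YH d (n + 1) q) (a : YH d n q) :
    braidExp hd n hq (y * incl d n q a) = braidExp hd n hq y * a := by
  rw [braidExp_apply, map_mul, Module.End.mul_apply, cosetRep_incl_vec, cosetRep_mul_const,
    cosetTheta_mul_const, braidExp_apply]

/-- Reduces left Y_n-linearity to the generators, for both kinds of projection at once. -/
theorem linearMap_cosetRep_incl (L : (ℕ → Frame d (YH d n q)) →ₗ[ℂ] YH d n q)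
    (hG : ∀ i, i + 1 < n → ∀ f, L (cosetG d n q (G d n q) (T d n q) i f) = G d n q i * L f)
    (hT : ∀ j, j < n → ∀ f, L (cosetT d n (T d n q) j f) = T d n q j * L f)
    (a : YH d n q) (f : ℕ → Frame d (YH d n q)) :
    L (cosetRep hd n hq (incl d n q a) f) = a * L f := by
  induction a using YH_induction hd generalizing f with
  | hG i hi => rw [incl_G d n q hi, cosetRep_G hd n hq (by omega), hG i hi]
  | hT j hj => rw [incl_T d n q hj, cosetRep_T hd n hq (by omega), hT j hj]
  | hc c =>
    rw [AlgHom.commutes, AlgHom.commutes, Module.algebraMap_end_apply, map_smul, Algebra.smul_def]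
  | hadd x y hx hy => simp only [map_add, LinearMap.add_apply, hx, hy, add_mul]
  | hmul x y hx hy => simp only [map_mul, Module.End.mul_apply, hx, hy, mul_assoc]

theorem condExp_incl_mul (s : ZMod d) (a : YH d n q) (y : YH d (n + 1) q) :
    condExp hd n hq s (incl d n q a * y) = a * condExp hd n hq s y := by
  rw [condExp_apply, map_mul, Module.End.mul_apply]
  exact linearMap_cosetRep_incl hd n hq (cosetCoeff d n s)
    (fun i hi f => cosetCoeff_cosetG s hi f) (fun j hj f => cosetCoeff_cosetT s hj f) a _

theorem braidExp_incl_mul (a : YH d n q) (y : YH d (n + 1) q) :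
    braidExp hd n hq (incl d n q a * y) = a * braidExp hd n hq y := by
  rw [braidExp_apply, map_mul, Module.End.mul_apply]
  exact linearMap_cosetRep_incl hd n hq (cosetTheta d n _ _)
    (fun i hi f => (yhFamily d n q).cosetTheta_cosetG hd hi f)
    (fun j hj f => (yhFamily d n q).cosetTheta_cosetT hd hj f) a _

theorem cosetRep_T_pow_vec (s : ℕ) : cosetRep hd n hq (T d (n + 1) q n ^ s) (cosetVec n) =
    Pi.single n (frameVar d ^ s) := by
  induction s with
  | zero => simp [cosetVec]
  | succ s ih =>
    rw [pow_succ', map_mul, Module.End.mul_apply, ih, cosetRep_T hd n hq le_rfl]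
    funext k
    rw [cosetT_apply]
    rcases eq_or_ne k n with rfl | hk
    · rw [cosetDiag_self le_rfl, Pi.single_eq_same, Pi.single_eq_same, pow_succ']
    · simp [hk]

theorem condExp_T_pow (s : ZMod d) (r : ℕ) :
    condExp hd n hq s (T d (n + 1) q n ^ r) = if (r : ZMod d) = s then 1 else 0 := by
  rw [condExp_apply, cosetRep_T_pow_vec, cosetCoeff_apply, Pi.single_eq_same, frameVar_pow,
    AddMonoidAlgebra.coeff_single, Finsupp.single_apply]

theorem braidExp_T_pow (r : ℕ) : braidExp hd n hq (T d (n + 1) q n ^ r) = 0 := by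
  rw [braidExp_apply, cosetRep_T_pow_vec, cosetTheta_apply]
  refine Finset.sum_eq_zero fun k hk => ?_
  rw [Pi.single_eq_of_ne (Finset.mem_range.1 hk).ne, map_zero, mul_zero]

theorem cosetRep_G_vec : cosetRep hd (n + 1) hq (G d (n + 2) q n) (cosetVec (n + 1)) =
    Pi.single n 1 := by
  rw [cosetRep_G hd (n + 1) hq (by omega)]
  funext k
  have h0 (k : ℕ) (hk : k ≠ n + 1) : (cosetVec (n + 1) : ℕ → Frame d (YH d (n + 1) q)) k = 0 :=
    Pi.single_eq_of_ne hk _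
  have h1 : (cosetVec (n + 1) : ℕ → Frame d (YH d (n + 1) q)) (n + 1) = 1 :=
    Pi.single_eq_same _ _
  rcases lt_trichotomy k n with hk | rfl | hk
  · rw [cosetG_lt (by omega) hk, h0 k (by omega), mul_zero, Pi.single_eq_of_ne hk.ne]
  · rw [cosetG_self (by omega), h0 k (by omega), h1, mul_zero, smul_zero, add_zero,
      Pi.single_eq_same]
  · rw [Pi.single_eq_of_ne hk.ne']
    rcases (show n + 1 ≤ k by omega).eq_or_lt with rfl | hk
    · rw [cosetG_succ le_rfl, h0 n (by omega)]
    · rw [cosetG_out hk, h0 k (by omega), smul_zero]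

theorem condExp_G (s : ZMod d) : condExp hd (n + 1) hq s (G d (n + 2) q n) = 0 := by
  rw [condExp_apply, cosetRep_G_vec, cosetCoeff_apply, Pi.single_eq_of_ne (by omega)]
  rfl

theorem braidExp_G : braidExp hd (n + 1) hq (G d (n + 2) q n) = 1 := by
  rw [braidExp_apply, cosetRep_G_vec, cosetTheta_apply, Finset.sum_eq_single n]
  · rw [Pi.single_eq_same, frameEval_one, mul_one, Nat.add_sub_cancel, Nat.sub_self, tailProd]
  · intro k _ hk
    rw [Pi.single_eq_of_ne hk, map_zero, mul_zero]
  · simp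

end condExp

/-! ### Spanning sets -/

section spanning

variable {d n : ℕ} {q : ℂ}

theorem T_comm_incl (hd : 1 ≤ d) (a : YH d n q) : Commute (T d (n + 1) q n) (incl d n q a) := by
  have hf := yhFamily d (n + 1) q
  induction a using YH_induction hd with
  | hG i hi =>
    rw [incl_G d n q hi]
    exact hf.t_g_far i n (by omega) (by omega) (by omega) (by omega)
  | hT j hj =>
    rw [incl_T d n q hj]
    exact hf.t_comm n j (by omega) (by omega)
  | hc c => rw [AlgHom.commutes]; exact (Algebra.commutes c _).symm
  | hadd x y hx hy => rw [map_add]; exact hx.add_right hy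
  | hmul x y hx hy => rw [map_mul]; exact hx.mul_right hy

theorem G_comm_incl (hd : 1 ≤ d) (a : YH d n q) :
    Commute (G d (n + 2) q n) (incl d (n + 1) q (incl d n q a)) := by
  have hf := yhFamily d (n + 2) q
  induction a using YH_induction hd with
  | hG i hi =>
    rw [incl_G d n q hi, incl_G d (n + 1) q (by omega)]
    exact (hf.far i n hi (by omega)).symm
  | hT j hj =>
    rw [incl_T d n q hj, incl_T d (n + 1) q (by omega)]
    exact (hf.t_g_far n j (by omega) (by omega) (by omega) (by omega)).symm
  | hc c => rw [AlgHom.commutes, AlgHom.commutes]; exact (Algebra.commutes c _).symm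
  | hadd x y hx hy => rw [map_add, map_add]; exact hx.add_right hy
  | hmul x y hx hy => rw [map_mul, map_mul]; exact hx.mul_right hy

/-- The element `e_{n+1} g_{n+1}` of `Y_{d,n+2}(q)` (in the numbering from `1`). -/
def EG (d n : ℕ) (q : ℂ) : YH d (n + 2) q :=
  frameAvg d (T d (n + 2) q n) (T d (n + 2) q (n + 1)) * G d (n + 2) q n

theorem G_mul_G (d n : ℕ) (q : ℂ) :
    G d (n + 2) q n * G d (n + 2) q n = 1 + (q - q⁻¹) • EG d n q :=
  (yhFamily d (n + 2) q).quad n (by omega)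

theorem G_mul_T_pow (d n : ℕ) (q : ℂ) (s : ℕ) :
    G d (n + 2) q n * T d (n + 2) q (n + 1) ^ s =
      incl d (n + 1) q (T d (n + 1) q n ^ s) * G d (n + 2) q n := by
  rw [map_pow, incl_T d (n + 1) q (by omega)]
  exact (SemiconjBy.pow_right
    (show SemiconjBy _ _ _ from ((yhFamily d (n + 2) q).t_g_left n (by omega)).symm) s).eq

theorem T_pow_mul_G (d n : ℕ) (q : ℂ) (s : ℕ) :
    T d (n + 2) q (n + 1) ^ s * G d (n + 2) q n =
      G d (n + 2) q n * incl d (n + 1) q (T d (n + 1) q n ^ s) := by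
  rw [map_pow, incl_T d (n + 1) q (by omega)]
  exact (SemiconjBy.pow_right
    (show SemiconjBy _ _ _ from ((yhFamily d (n + 2) q).t_g_right n (by omega)).symm) s).eq.symm

/-- Pushing the framing of the last strand through the crossing leaves factors from the smaller
algebra on both sides. -/
theorem EG_eq_sum (d n : ℕ) (q : ℂ) : EG d n q = (d : ℂ)⁻¹ • ∑ s ∈ Finset.range d,
    incl d (n + 1) q (T d (n + 1) q n ^ s) * G d (n + 2) q n *
      incl d (n + 1) q (T d (n + 1) q n ^ (d - s)) := by
  rw [EG, frameAvg, smul_mul_assoc, Finset.sum_mul]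
  congr 1
  refine Finset.sum_congr rfl fun s _ => ?_
  rw [mul_assoc, T_pow_mul_G, ← mul_assoc, map_pow, map_pow, incl_T d (n + 1) q (by omega)]

theorem EG_mul_T_pow (d n : ℕ) (q : ℂ) (s : ℕ) :
    EG d n q * T d (n + 2) q (n + 1) ^ s =
      incl d (n + 1) q (T d (n + 1) q n ^ s) * EG d n q := by
  have hf := yhFamily d (n + 2) q
  have hc : Commute (T d (n + 2) q n ^ s)
      (frameAvg d (T d (n + 2) q n) (T d (n + 2) q (n + 1))) :=
    (commute_frameAvg (Commute.refl _) (hf.t_comm n (n + 1) (by omega) (by omega))).pow_left s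
  rw [EG, mul_assoc, G_mul_T_pow, map_pow, incl_T d (n + 1) q (by omega), ← mul_assoc, ← hc.eq,
    mul_assoc]

/-- u commutes with the crossing and the framing slides through it, so the two crossings meet and
their square can be expanded. -/
theorem G_mul_incl_T_mul_G (hd : 1 ≤ d) (u : YH d n q) (s : ℕ) :
    G d (n + 2) q n * incl d (n + 1) q (incl d n q u * T d (n + 1) q n ^ s) * G d (n + 2) q n =
      incl d (n + 1) q (incl d n q u) * T d (n + 2) q (n + 1) ^ s +
        (q - q⁻¹) • (incl d (n + 1) q (incl d n q u * T d (n + 1) q n ^ s) * EG d n q) := by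
  rw [map_mul, ← mul_assoc, (G_comm_incl hd u).eq, mul_assoc, mul_assoc, ← G_mul_T_pow,
    ← mul_assoc (G d (n + 2) q n), G_mul_G, add_mul, one_mul, mul_add, smul_mul_assoc,
    mul_smul_comm, EG_mul_T_pow, ← mul_assoc]

/-- u and v commute with the outer crossings, which leaves one side of a braid relation. -/
theorem G_mul_incl_G_mul_G (hd : 1 ≤ d) (u v : YH d (n + 1) q) :
    G d (n + 3) q (n + 1) * incl d (n + 2) q (incl d (n + 1) q u * G d (n + 2) q n *
      incl d (n + 1) q v) * G d (n + 3) q (n + 1) =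
    incl d (n + 2) q (incl d (n + 1) q u * G d (n + 2) q n) * G d (n + 3) q (n + 1) *
      incl d (n + 2) q (G d (n + 2) q n * incl d (n + 1) q v) := by
  have hb := (yhFamily d (n + 3) q).braid n (by omega)
  rw [← incl_G d (n + 2) q (i := n) (by omega)] at hb
  simp only [map_mul]
  rw [← mul_assoc, ← mul_assoc, (G_comm_incl hd u).eq]
  simp only [mul_assoc]
  rw [← (G_comm_incl hd v).eq]
  congr 1
  simp only [← mul_assoc, hb]

variable (d n q) in
/-- The span of the elements `a t_{n+1}^s` and `a g_n b` with `a` and `b` in `Y_{d,n}(q)`. -/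
def markovSpan : Submodule ℂ (YH d (n + 1) q) :=
  Submodule.span ℂ ({y | ∃ a s, y = incl d n q a * T d (n + 1) q n ^ s} ∪
    -- For n = 0 there is no crossing, and at the truncated index n - 1 = 0 the value of `G` would
    -- be the default 1.
    {y | ∃ a b, 1 ≤ n ∧ y = incl d n q a * G d (n + 1) q (n - 1) * incl d n q b})

theorem markovSpan_T (a : YH d n q) (s : ℕ) :
    incl d n q a * T d (n + 1) q n ^ s ∈ markovSpan d n q :=
  Submodule.subset_span (Or.inl ⟨a, s, rfl⟩)

theorem markovSpan_G (a b : YH d (n + 1) q) :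
    incl d (n + 1) q a * G d (n + 2) q n * incl d (n + 1) q b ∈ markovSpan d (n + 1) q :=
  Submodule.subset_span (Or.inr ⟨a, b, by omega, rfl⟩)

/-- Induction on the elements of `markovSpan`. -/
theorem markovSpan_induction {p : (y : YH d (n + 1) q) → y ∈ markovSpan d n q → Prop}
    (hT : ∀ a s, p (incl d n q a * T d (n + 1) q n ^ s) (markovSpan_T a s))
    (hG : ∀ a b (hn : 1 ≤ n), p (incl d n q a * G d (n + 1) q (n - 1) * incl d n q b)
      (Submodule.subset_span (Or.inr ⟨a, b, hn, rfl⟩)))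
    (hadd : ∀ x y hx hy, p x hx → p y hy → p (x + y) (add_mem hx hy))
    (hsmul : ∀ (c : ℂ) x hx, p x hx → p (c • x) (Submodule.smul_mem _ c hx))
    {y : YH d (n + 1) q} (hy : y ∈ markovSpan d n q) : p y hy := by
  induction hy using Submodule.span_induction with
  | mem x hx =>
    rcases hx with ⟨a, s, rfl⟩ | ⟨a, b, hn, rfl⟩
    · exact hT a s
    · exact hG a b hn
  | zero =>
    have h := hsmul 0 _ _ (hT 0 0)
    simp only [zero_smul] at h
    exact h
  | add x y hx hy hx' hy' => exact hadd x y hx hy hx' hy'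
  | smul c x hx hx' => exact hsmul c x hx hx'

theorem incl_mul_mem_markovSpan (a : YH d n q) {x : YH d (n + 1) q} (hx : x ∈ markovSpan d n q) :
    incl d n q a * x ∈ markovSpan d n q := by
  induction hx using markovSpan_induction with
  | hT b s => rw [← mul_assoc, ← map_mul]; exact markovSpan_T _ _
  | hG b c hn =>
    rw [← mul_assoc, ← mul_assoc, ← map_mul]
    exact Submodule.subset_span (Or.inr ⟨_, _, hn, rfl⟩)
  | hadd x y _ _ hx hy => rw [mul_add]; exact add_mem hx hy
  | hsmul c x _ hx => rw [mul_smul_comm]; exact Submodule.smul_mem _ c hx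

theorem mul_incl_mem_markovSpan (hd : 1 ≤ d) (a : YH d n q) {x : YH d (n + 1) q}
    (hx : x ∈ markovSpan d n q) : x * incl d n q a ∈ markovSpan d n q := by
  induction hx using markovSpan_induction with
  | hT b s =>
    rw [mul_assoc, ((T_comm_incl hd a).pow_left s).eq, ← mul_assoc, ← map_mul]
    exact markovSpan_T _ _
  | hG b c hn =>
    rw [mul_assoc, ← map_mul]
    exact Submodule.subset_span (Or.inr ⟨_, _, hn, rfl⟩)
  | hadd x y _ _ hx hy => rw [add_mul]; exact add_mem hx hy
  | hsmul c x _ hx => rw [smul_mul_assoc]; exact Submodule.smul_mem _ c hx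

theorem T_mul_mem_markovSpan (hd : 1 ≤ d) {x : YH d (n + 1) q} (hx : x ∈ markovSpan d n q) :
    T d (n + 1) q n * x ∈ markovSpan d n q := by
  induction hx using markovSpan_induction with
  | hT b s =>
    rw [← mul_assoc, (T_comm_incl hd b).eq, mul_assoc, ← pow_succ']
    exact markovSpan_T _ _
  | hG b c hn =>
    obtain ⟨n, rfl⟩ : ∃ m, n = m + 1 := ⟨n - 1, by omega⟩
    have h := T_pow_mul_G d n q 1
    rw [pow_one, pow_one] at h
    rw [Nat.add_sub_cancel, ← mul_assoc, ← mul_assoc, (T_comm_incl hd b).eq, mul_assoc _ (T _ _ _ _),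
      h, mul_assoc, mul_assoc, ← map_mul, ← mul_assoc]
    exact markovSpan_G _ _
  | hadd x y _ _ hx hy => rw [mul_add]; exact add_mem hx hy
  | hsmul c x _ hx => rw [mul_smul_comm]; exact Submodule.smul_mem _ c hx

theorem EG_mem_markovSpan (d n : ℕ) (q : ℂ) : EG d n q ∈ markovSpan d (n + 1) q := by
  rw [EG_eq_sum]
  exact Submodule.smul_mem _ _ (Submodule.sum_mem _ fun s _ => markovSpan_G _ _)

/-- The critical product is g b g. Decomposing b by the lower spanning statement, either the two
crossings meet and the quadratic relation applies, or a braid relation leaves a single outer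
crossing. -/
theorem G_mul_mem_markovSpan (hd : 1 ≤ d) (ih : ∀ a : YH d (n + 1) q, a ∈ markovSpan d n q)
    {x : YH d (n + 2) q} (hx : x ∈ markovSpan d (n + 1) q) :
    G d (n + 2) q n * x ∈ markovSpan d (n + 1) q := by
  induction hx using markovSpan_induction with
  | hT b s =>
    rw [← ((T_comm_incl hd b).pow_left s).eq, ← mul_assoc, G_mul_T_pow]
    exact markovSpan_G _ _
  | hG b c hn =>
    rw [Nat.add_sub_cancel, ← mul_assoc, ← mul_assoc]
    refine mul_incl_mem_markovSpan hd c ?_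
    induction ih b using markovSpan_induction with
    | hT u s =>
      rw [G_mul_incl_T_mul_G hd]
      exact add_mem (markovSpan_T _ _)
        (Submodule.smul_mem _ _ (incl_mul_mem_markovSpan _ (EG_mem_markovSpan d n q)))
    | hG u v hn =>
      obtain ⟨n, rfl⟩ : ∃ m, n = m + 1 := ⟨n - 1, by omega⟩
      rw [Nat.add_sub_cancel, G_mul_incl_G_mul_G hd]
      exact markovSpan_G _ _
    | hadd x y _ _ hx hy => rw [map_add, mul_add, add_mul]; exact add_mem hx hy
    | hsmul c x _ hx =>
      rw [map_smul, mul_smul_comm, smul_mul_assoc]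
      exact Submodule.smul_mem _ c hx
  | hadd x y _ _ hx hy => rw [mul_add]; exact add_mem hx hy
  | hsmul c x _ hx => rw [mul_smul_comm]; exact Submodule.smul_mem _ c hx

/-- The span contains 1 and is stable under left multiplication by the generators. -/
theorem mem_markovSpan (hd : 1 ≤ d) (n : ℕ) (y : YH d (n + 1) q) : y ∈ markovSpan d n q := by
  induction n with
  | zero =>
    have key (y x : YH d 1 q) (hx : x ∈ markovSpan d 0 q) : y * x ∈ markovSpan d 0 q := by
      induction y using YH_induction hd generalizing x with
      | hG i hi => omega
      | hT j hj =>
        obtain rfl : j = 0 := by omega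
        exact T_mul_mem_markovSpan hd hx
      | hc c => rw [← Algebra.smul_def]; exact Submodule.smul_mem _ c hx
      | hadd a b ha hb => rw [add_mul]; exact add_mem (ha x hx) (hb x hx)
      | hmul a b ha hb => rw [mul_assoc]; exact ha _ (hb x hx)
    simpa using key y 1 (by simpa using markovSpan_T (1 : YH d 0 q) 0)
  | succ n ih =>
    have key (y x : YH d (n + 2) q) (hx : x ∈ markovSpan d (n + 1) q) :
        y * x ∈ markovSpan d (n + 1) q := by
      induction y using YH_induction hd generalizing x with
      | hG i hi =>
        rcases (show i ≤ n by omega).eq_or_lt with rfl | hi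
        · exact G_mul_mem_markovSpan hd ih hx
        · rw [← incl_G d (n + 1) q (by omega)]
          exact incl_mul_mem_markovSpan _ hx
      | hT j hj =>
        rcases (show j ≤ n + 1 by omega).eq_or_lt with rfl | hj
        · exact T_mul_mem_markovSpan hd hx
        · rw [← incl_T d (n + 1) q hj]
          exact incl_mul_mem_markovSpan _ hx
      | hc c => rw [← Algebra.smul_def]; exact Submodule.smul_mem _ c hx
      | hadd a b ha hb => rw [add_mul]; exact add_mem (ha x hx) (hb x hx)
      | hmul a b ha hb => rw [mul_assoc]; exact ha _ (hb x hx)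
    simpa using key y 1 (by simpa using markovSpan_T (1 : YH d (n + 1) q) 0)

end spanning

/-! ### Uniqueness of the trace -/

section uniqueness

variable {d : ℕ} {q : ℂ} {tr tr' : (n : ℕ) → YH d n q →ₗ[ℂ] TraceRing d}

theorem IsMarkovTrace.tr_G (h : IsMarkovTrace d q tr) (m : ℕ) (a b : YH d (m + 1) q) :
    tr (m + 2) (incl d (m + 1) q a * G d (m + 2) q m * incl d (m + 1) q b) =
      MvPolynomial.X TraceVar.z * tr (m + 1) (b * a) := by
  rw [h.comm, ← mul_assoc, ← map_mul, G_eq d (m + 2) q (Nat.lt_succ_self (m + 1)), h.markov]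

theorem IsMarkovTrace.unique (hd : 1 ≤ d) (h : IsMarkovTrace d q tr)
    (h' : IsMarkovTrace d q tr') : tr = tr' := by
  funext n
  induction n with
  | zero =>
    have key (a : YH d 0 q) : ∃ c : ℂ, a = algebraMap ℂ _ c := by
      induction a using YH_induction hd with
      | hG i hi => omega
      | hT j hj => omega
      | hc c => exact ⟨c, rfl⟩
      | hadd a b ha hb =>
        obtain ⟨x, rfl⟩ := ha
        obtain ⟨y, rfl⟩ := hb
        exact ⟨x + y, (map_add _ _ _).symm⟩
      | hmul a b ha hb =>
        obtain ⟨x, rfl⟩ := ha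
        obtain ⟨y, rfl⟩ := hb
        exact ⟨x * y, (map_mul _ _ _).symm⟩
    refine LinearMap.ext fun a => ?_
    obtain ⟨c, rfl⟩ := key a
    rw [Algebra.algebraMap_eq_smul_one, map_smul, map_smul, h.one, h'.one]
  | succ n ih =>
    refine LinearMap.ext fun y => ?_
    induction mem_markovSpan hd n y using markovSpan_induction with
    | hT a s =>
      -- The framing rule covers only exponents 1, …, d - 1, so s is reduced modulo d; residue 0 is
      -- compatibility with the inclusion.
      rw [← Nat.mod_add_div s d, pow_add, pow_mul, (yhFamily d (n + 1) q).t_pow n (by omega),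
        one_pow, mul_one]
      rcases Nat.eq_zero_or_pos (s % d) with hs | hs
      · rw [hs, pow_zero, mul_one, h.compat, h'.compat, ih]
      · have hs' : s % d < d := Nat.mod_lt _ hd
        have e1 := h.framing n a (s % d) hs hs'
        have e2 := h'.framing n a (s % d) hs hs'
        rw [← ih] at e2
        rw [T_eq d (n + 1) q (Nat.lt_succ_self n)]
        exact e1.trans e2.symm
    | hG a b hn =>
      obtain ⟨n, rfl⟩ : ∃ m, n = m + 1 := ⟨n - 1, by omega⟩
      rw [Nat.add_sub_cancel, h.tr_G, h'.tr_G, ih]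
    | hadd x y _ _ hx hy => rw [map_add, map_add, hx, hy]
    | hsmul c x _ hx => rw [map_smul, map_smul, hx]

end uniqueness

/-! ### Existence of the trace -/

section existence

/-- The variable `x_s`, with `x_0 = 1`. -/
def framingVar (d s : ℕ) : TraceRing d :=
  if h : 1 ≤ s ∧ s < d then MvPolynomial.X (TraceVar.x s h.1 h.2) else 1

theorem framingVar_zero (d : ℕ) : framingVar d 0 = 1 := dif_neg (by omega)

variable {d : ℕ} (hd : 1 ≤ d) {q : ℂ} (hq : q ≠ 0)

theorem yhFamily_zero (d : ℕ) (q : ℂ) :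
    YHFamily d 0 q (fun _ => (1 : TraceRing d)) (fun _ => 1) := by
  constructor <;> intros <;> omega

/-- The Markov trace. -/
def markovTrace : (n : ℕ) → YH d n q →ₗ[ℂ] TraceRing d
  -- On zero strands there are no generators, so the relations are vacuous and the algebra consists
  -- of scalars.
  | 0 => ((yhFamily_zero d q).lift hd).toLinearMap
  | n + 1 => ∑ s ∈ Finset.range d, framingVar d s • (markovTrace n ∘ₗ condExp hd n hq (s : ZMod d)) +
      (MvPolynomial.X TraceVar.z : TraceRing d) • (markovTrace n ∘ₗ braidExp hd n hq)

theorem markovTrace_succ (n : ℕ) (y : YH d (n + 1) q) : markovTrace hd hq (n + 1) y =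
    ∑ s ∈ Finset.range d, framingVar d s * markovTrace hd hq n (condExp hd n hq (s : ZMod d) y) +
      MvPolynomial.X TraceVar.z * markovTrace hd hq n (braidExp hd n hq y) := by
  simp [markovTrace]

theorem markovTrace_T (n : ℕ) (a : YH d n q) (s : ℕ) :
    markovTrace hd hq (n + 1) (incl d n q a * T d (n + 1) q n ^ s) =
      framingVar d (s % d) * markovTrace hd hq n a := by
  rw [markovTrace_succ, braidExp_incl_mul, braidExp_T_pow, mul_zero, map_zero, mul_zero, add_zero,
    Finset.sum_eq_single (s % d)]
  · rw [condExp_incl_mul, condExp_T_pow, if_pos (by simp), mul_one]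
  · intro r hr hne
    rw [condExp_incl_mul, condExp_T_pow, if_neg, mul_zero, map_zero, mul_zero]
    rw [ZMod.natCast_eq_natCast_iff', Nat.mod_eq_of_lt (Finset.mem_range.1 hr)]
    exact hne.symm
  · intro hs
    exact absurd (Finset.mem_range.2 (Nat.mod_lt s hd)) hs

theorem markovTrace_incl (n : ℕ) (a : YH d n q) :
    markovTrace hd hq (n + 1) (incl d n q a) = markovTrace hd hq n a := by
  have h := markovTrace_T hd hq n a 0
  rwa [pow_zero, mul_one, Nat.zero_mod, framingVar_zero, one_mul] at h

theorem markovTrace_one (n : ℕ) : markovTrace hd hq n (1 : YH d n q) = 1 := by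
  induction n with
  | zero => exact map_one ((yhFamily_zero d q).lift hd)
  | succ n ih => rw [← map_one (incl d n q), markovTrace_incl, ih]

theorem markovTrace_G (n : ℕ) (a b : YH d (n + 1) q) :
    markovTrace hd hq (n + 2) (incl d (n + 1) q a * G d (n + 2) q n * incl d (n + 1) q b) =
      MvPolynomial.X TraceVar.z * markovTrace hd hq (n + 1) (a * b) := by
  rw [markovTrace_succ, braidExp_mul_incl, braidExp_incl_mul, braidExp_G, mul_one,
    Finset.sum_eq_zero, zero_add]
  intro s _
  rw [condExp_mul_incl, condExp_incl_mul, condExp_G, mul_zero, zero_mul, map_zero, mul_zero]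

/-- In each summand of the average the framings around the crossing cancel under the trace, t^s
t^{d-s} = 1. The d summands are equal and the factor 1/d removes their number. -/
theorem markovTrace_EG (n : ℕ) (a b : YH d (n + 1) q) :
    markovTrace hd hq (n + 2) (incl d (n + 1) q a * EG d n q * incl d (n + 1) q b) =
      MvPolynomial.X TraceVar.z * markovTrace hd hq (n + 1) (a * b) := by
  have key (s : ℕ) (hs : s ∈ Finset.range d) : markovTrace hd hq (n + 2) (incl d (n + 1) q a *
      (incl d (n + 1) q (T d (n + 1) q n ^ s) * G d (n + 2) q n *
        incl d (n + 1) q (T d (n + 1) q n ^ (d - s))) * incl d (n + 1) q b) =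
      MvPolynomial.X TraceVar.z * markovTrace hd hq (n + 1) (a * b) := by
    rw [mul_assoc, mul_assoc, ← map_mul, ← mul_assoc, ← mul_assoc, ← map_mul, markovTrace_G,
      mul_assoc, ← mul_assoc (_ ^ s), ← pow_add, Nat.add_sub_cancel' (Finset.mem_range.1 hs).le,
      (yhFamily d (n + 1) q).t_pow n (by omega), one_mul]
  rw [EG_eq_sum, mul_smul_comm, smul_mul_assoc, Finset.mul_sum, Finset.sum_mul, map_smul, map_sum,
    Finset.sum_congr rfl key, Finset.sum_const, Finset.card_range, ← Nat.cast_smul_eq_nsmul ℂ,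
    smul_smul, inv_mul_cancel₀ (by exact_mod_cast (by omega)), one_smul]

/-- The projections are bimodule maps, so commuting with Y_n is inherited from the trace on Y_n. -/
theorem markovTrace_incl_comm {n : ℕ}
    (hn : ∀ a b : YH d n q, markovTrace hd hq n (a * b) = markovTrace hd hq n (b * a))
    (a : YH d n q) (y : YH d (n + 1) q) :
    markovTrace hd hq (n + 1) (incl d n q a * y) = markovTrace hd hq (n + 1) (y * incl d n q a) := by
  simp only [markovTrace_succ, condExp_incl_mul, condExp_mul_incl, braidExp_incl_mul,
    braidExp_mul_incl, hn a]

/-! ### Symmetry of the form tr(g a g b) -/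

theorem markovTrace_GTG (n : ℕ) (u : YH d n q) (s : ℕ) (b : YH d (n + 1) q) :
    markovTrace hd hq (n + 2) (G d (n + 2) q n *
      incl d (n + 1) q (incl d n q u * T d (n + 1) q n ^ s) * G d (n + 2) q n *
      incl d (n + 1) q b) =
    framingVar d (s % d) * markovTrace hd hq (n + 1) (incl d n q u * b) + (q - q⁻¹) •
      (MvPolynomial.X TraceVar.z *
        markovTrace hd hq (n + 1) (incl d n q u * T d (n + 1) q n ^ s * b)) := by
  rw [G_mul_incl_T_mul_G hd, add_mul, smul_mul_assoc, map_add, map_smul, markovTrace_EG, mul_assoc,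
    ((T_comm_incl hd b).pow_left s).eq, ← mul_assoc, ← map_mul, markovTrace_T]

theorem markovTrace_GGG (n : ℕ) (u v : YH d (n + 1) q) (b : YH d (n + 2) q) :
    markovTrace hd hq (n + 3) (G d (n + 3) q (n + 1) * incl d (n + 2) q
      (incl d (n + 1) q u * G d (n + 2) q n * incl d (n + 1) q v) * G d (n + 3) q (n + 1) *
      incl d (n + 2) q b) =
    MvPolynomial.X TraceVar.z * markovTrace hd hq (n + 2)
      (incl d (n + 1) q u * (G d (n + 2) q n * G d (n + 2) q n) * (incl d (n + 1) q v * b)) := by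
  rw [G_mul_incl_G_mul_G hd, mul_assoc, ← map_mul, markovTrace_G]
  simp only [mul_assoc]

/-- Moving `e_{n+1}` from the second `g_{n+1}` to the first under the trace. -/
theorem markovTrace_move_avg {n : ℕ}
    (hn : ∀ a b : YH d (n + 2) q,
      markovTrace hd hq (n + 2) (a * b) = markovTrace hd hq (n + 2) (b * a))
    (u y w : YH d (n + 1) q) :
    markovTrace hd hq (n + 2) (incl d (n + 1) q u * G d (n + 2) q n * incl d (n + 1) q y *
      EG d n q * incl d (n + 1) q w) =
    markovTrace hd hq (n + 2) (incl d (n + 1) q u * EG d n q * incl d (n + 1) q y *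
      G d (n + 2) q n * incl d (n + 1) q w) := by
  have hf := yhFamily d (n + 2) q
  have hc : Commute (T d (n + 2) q n) (T d (n + 2) q (n + 1)) :=
    hf.t_comm n (n + 1) (by omega) (by omega)
  -- t_n^r slides through the second crossing, becomes t_{n+1}^r, passes w, and travels around the
  -- trace and past u. t_{n+1}^k moves back over y and through the first crossing, becoming t_n^k.
  -- The exponents come out exchanged, and the symmetry of the average repairs this.
  have key (r k : ℕ) : markovTrace hd hq (n + 2) (incl d (n + 1) q u * G d (n + 2) q n *
      incl d (n + 1) q y * (T d (n + 2) q n ^ r * T d (n + 2) q (n + 1) ^ k * G d (n + 2) q n) *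
        incl d (n + 1) q w) =
      markovTrace hd hq (n + 2) (incl d (n + 1) q u * (T d (n + 2) q (n + 1) ^ r *
        T d (n + 2) q n ^ k * G d (n + 2) q n) * incl d (n + 1) q y * G d (n + 2) q n *
          incl d (n + 1) q w) := by
    have h1 (s : ℕ) : T d (n + 2) q n ^ s * G d (n + 2) q n =
        G d (n + 2) q n * T d (n + 2) q (n + 1) ^ s := by
      rw [G_mul_T_pow, map_pow, incl_T d (n + 1) q (by omega)]
    have h2 (s : ℕ) (a : YH d (n + 1) q) : T d (n + 2) q (n + 1) ^ s * incl d (n + 1) q a =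
        incl d (n + 1) q a * T d (n + 2) q (n + 1) ^ s := ((T_comm_incl hd a).pow_left s).eq
    have e1 : incl d (n + 1) q u * G d (n + 2) q n *
        incl d (n + 1) q y * (T d (n + 2) q n ^ r * T d (n + 2) q (n + 1) ^ k * G d (n + 2) q n) *
          incl d (n + 1) q w =
        (incl d (n + 1) q u * T d (n + 2) q n ^ k * G d (n + 2) q n * incl d (n + 1) q y *
          G d (n + 2) q n * incl d (n + 1) q w) * T d (n + 2) q (n + 1) ^ r := by
      rw [(hc.pow_pow r k).eq, mul_assoc (_ ^ k), h1]
      simp only [mul_assoc]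
      rw [← h2 r w, ← mul_assoc (T d (n + 2) q n ^ k), h1]
      simp only [mul_assoc]
      rw [← mul_assoc (_ ^ k) (incl d (n + 1) q y), h2 k y]
      simp only [mul_assoc]
    rw [e1, hn]
    simp only [← mul_assoc]
    rw [h2 r u]
  have e2 : EG d n q = frameAvg d (T d (n + 2) q (n + 1)) (T d (n + 2) q n) * G d (n + 2) q n := by
    rw [EG, frameAvg_comm hc (hf.t_pow _ (by omega)) (hf.t_pow _ (by omega))]
  nth_rewrite 2 [e2]
  simp only [EG, frameAvg, smul_mul_assoc, mul_smul_comm, Finset.sum_mul, Finset.mul_sum, map_smul,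
    map_sum, key]

/-- The form `tr (g a g b)` is symmetric. -/
theorem markovTrace_symm {n : ℕ}
    (hn : ∀ m ≤ n + 1, ∀ a b : YH d m q,
      markovTrace hd hq m (a * b) = markovTrace hd hq m (b * a))
    (a b : YH d (n + 1) q) :
    markovTrace hd hq (n + 2) (G d (n + 2) q n * incl d (n + 1) q a * G d (n + 2) q n *
      incl d (n + 1) q b) =
    markovTrace hd hq (n + 2) (G d (n + 2) q n * incl d (n + 1) q b * G d (n + 2) q n *
      incl d (n + 1) q a) := by
  -- One argument a framing term, the other containing a crossing: both sides reduce to z x_s tr(u v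
  -- w) + (q - q⁻¹) z² tr(u v t^s w), with x_s read modulo d.
  have mixed (u v w : YH d n q) (s : ℕ) (h1 : 1 ≤ n) :
      markovTrace hd hq (n + 2) (G d (n + 2) q n *
        incl d (n + 1) q (incl d n q u * T d (n + 1) q n ^ s) * G d (n + 2) q n *
        incl d (n + 1) q (incl d n q v * G d (n + 1) q (n - 1) * incl d n q w)) =
      markovTrace hd hq (n + 2) (G d (n + 2) q n *
        incl d (n + 1) q (incl d n q v * G d (n + 1) q (n - 1) * incl d n q w) *
        G d (n + 2) q n * incl d (n + 1) q (incl d n q u * T d (n + 1) q n ^ s)) := by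
    obtain ⟨n, rfl⟩ : ∃ m, n = m + 1 := ⟨n - 1, by omega⟩
    have c := hn (n + 1) (by omega)
    have hT (x : YH d (n + 1) q) : T d (n + 2) q (n + 1) ^ s * incl d (n + 1) q x =
        incl d (n + 1) q x * T d (n + 2) q (n + 1) ^ s := ((T_comm_incl hd x).pow_left s).eq
    have e1 : incl d (n + 1) q u * (incl d (n + 1) q v * G d (n + 2) q n * incl d (n + 1) q w) =
        incl d (n + 1) q (u * v) * G d (n + 2) q n * incl d (n + 1) q w := by
      simp only [map_mul, mul_assoc]
    have e2 : incl d (n + 1) q u * T d (n + 2) q (n + 1) ^ s *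
        (incl d (n + 1) q v * G d (n + 2) q n * incl d (n + 1) q w) =
        incl d (n + 1) q (u * v) * G d (n + 2) q n *
          incl d (n + 1) q (T d (n + 1) q n ^ s * w) := by
      rw [mul_assoc, ← mul_assoc (_ ^ s), ← mul_assoc (_ ^ s), hT v, mul_assoc _ (_ ^ s),
        T_pow_mul_G]
      simp only [map_mul, mul_assoc]
    have e3 : incl d (n + 1) q v * (incl d (n + 1) q w *
        (incl d (n + 1) q u * T d (n + 2) q (n + 1) ^ s)) =
        incl d (n + 1) q (v * w * u) * T d (n + 2) q (n + 1) ^ s := by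
      simp only [map_mul, mul_assoc]
    have e4 : incl d (n + 1) q v * EG d n q * (incl d (n + 1) q w *
        (incl d (n + 1) q u * T d (n + 2) q (n + 1) ^ s)) =
        incl d (n + 1) q (v * T d (n + 1) q n ^ s) * EG d n q * incl d (n + 1) q (w * u) := by
      rw [← hT u, ← mul_assoc (incl d (n + 1) q w), ← hT w, ← mul_assoc, ← mul_assoc,
        mul_assoc _ (EG d n q), EG_mul_T_pow]
      simp only [map_mul, mul_assoc]
    have e5 : markovTrace hd hq (n + 1) (v * w * u) = markovTrace hd hq (n + 1) (u * v * w) := by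
      rw [c, mul_assoc]
    have e6 : markovTrace hd hq (n + 1) (v * T d (n + 1) q n ^ s * (w * u)) =
        markovTrace hd hq (n + 1) (u * v * (T d (n + 1) q n ^ s * w)) := by
      rw [← mul_assoc, c]
      simp only [mul_assoc]
    rw [Nat.add_sub_cancel, markovTrace_GTG, markovTrace_GGG, G_mul_G, mul_add, mul_one, add_mul,
      mul_smul_comm, smul_mul_assoc, map_add, map_smul, e1, e2, e3, e4, markovTrace_G,
      markovTrace_G, markovTrace_T, markovTrace_EG, e5, e6, mul_add, mul_smul_comm,
      mul_left_comm (framingVar d (s % d))]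
  induction mem_markovSpan hd n a using markovSpan_induction with
  | hT u s =>
    induction mem_markovSpan hd n b using markovSpan_induction with
    | hT v r =>
      have e1 (u v : YH d n q) (s : ℕ) :
          incl d n q u * (incl d n q v * T d (n + 1) q n ^ s) =
            incl d n q (u * v) * T d (n + 1) q n ^ s := by
        rw [map_mul, mul_assoc]
      have e2 (u v : YH d n q) (s r : ℕ) :
          incl d n q u * T d (n + 1) q n ^ s * (incl d n q v * T d (n + 1) q n ^ r) =
            incl d n q (u * v) * T d (n + 1) q n ^ (s + r) := by
        rw [mul_assoc, ← mul_assoc (_ ^ s), ((T_comm_incl hd v).pow_left s).eq, mul_assoc,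
          ← pow_add, e1]
      rw [markovTrace_GTG, markovTrace_GTG, e1, e1, e2, e2, markovTrace_T, markovTrace_T,
        markovTrace_T, markovTrace_T, hn n (by omega) u v, add_comm s r,
        mul_left_comm (framingVar d (s % d))]
    | hG v w h1 => exact mixed u v w s h1
    | hadd x y _ _ hx hy => simp only [map_add, mul_add, add_mul, hx, hy]
    | hsmul c x _ hx => simp only [map_smul, mul_smul_comm, smul_mul_assoc, hx]
  | hG u v h1 =>
    induction mem_markovSpan hd n b using markovSpan_induction with
    | hT w s => exact (mixed w u v s h1).symm
    | hG p w _ =>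
      -- Both sides become z times the trace of a word with one squared and one simple crossing, the
      -- square standing at different places. After expansion the terms without e agree by the
      -- Markov rule, and those with e by `markovTrace_move_avg`.
      obtain ⟨n, rfl⟩ : ∃ m, n = m + 1 := ⟨n - 1, by omega⟩
      have c := hn (n + 2) (by omega)
      have e1 : markovTrace hd hq (n + 2) (incl d (n + 1) q p *
          (G d (n + 2) q n * G d (n + 2) q n) * (incl d (n + 1) q w *
            (incl d (n + 1) q u * G d (n + 2) q n * incl d (n + 1) q v))) =
          markovTrace hd hq (n + 2) (incl d (n + 1) q u * G d (n + 2) q n *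
            incl d (n + 1) q (v * p) * (G d (n + 2) q n * G d (n + 2) q n) *
              incl d (n + 1) q w) := by
        rw [← mul_assoc (_ * _) (incl d (n + 1) q w), c]
        simp only [map_mul, mul_assoc]
      have e2 : incl d (n + 1) q u * (G d (n + 2) q n * G d (n + 2) q n) *
          (incl d (n + 1) q v * (incl d (n + 1) q p * G d (n + 2) q n * incl d (n + 1) q w)) =
          incl d (n + 1) q u * (G d (n + 2) q n * G d (n + 2) q n) * incl d (n + 1) q (v * p) *
            G d (n + 2) q n * incl d (n + 1) q w := by
        simp only [map_mul, mul_assoc]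
      have e3 : incl d (n + 1) q u * G d (n + 2) q n * incl d (n + 1) q (v * p) *
          incl d (n + 1) q w =
          incl d (n + 1) q u * G d (n + 2) q n * incl d (n + 1) q (v * p * w) := by
        simp only [map_mul, mul_assoc]
      have e4 : incl d (n + 1) q u * incl d (n + 1) q (v * p) * G d (n + 2) q n *
          incl d (n + 1) q w =
          incl d (n + 1) q (u * (v * p)) * G d (n + 2) q n * incl d (n + 1) q w := by
        simp only [map_mul, mul_assoc]
      rw [Nat.add_sub_cancel, markovTrace_GGG, markovTrace_GGG, e1, e2, G_mul_G]
      simp only [mul_add, add_mul, mul_one, mul_smul_comm, smul_mul_assoc, map_add, map_smul]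
      rw [markovTrace_move_avg hd hq c, e3, e4, markovTrace_G, markovTrace_G]
      simp only [mul_assoc]
    | hadd x y _ _ hx hy => simp only [map_add, mul_add, add_mul, hx, hy]
    | hsmul c x _ hx => simp only [map_smul, mul_smul_comm, smul_mul_assoc, hx]
  | hadd x y _ _ hx hy => simp only [map_add, mul_add, add_mul, hx, hy]
  | hsmul c x _ hx => simp only [map_smul, mul_smul_comm, smul_mul_assoc, hx]

/-- On a g b, the last framing slides through the crossing from either side and lands between a and
b. -/
theorem markovTrace_T_comm {n : ℕ}
    (hn : ∀ a b : YH d n q, markovTrace hd hq n (a * b) = markovTrace hd hq n (b * a))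
    (x : YH d (n + 1) q) :
    markovTrace hd hq (n + 1) (T d (n + 1) q n * x) =
      markovTrace hd hq (n + 1) (x * T d (n + 1) q n) := by
  induction mem_markovSpan hd n x using markovSpan_induction with
  | hT a s =>
    rw [← mul_assoc, (T_comm_incl hd a).eq, mul_assoc, mul_assoc, ← pow_succ', ← pow_succ]
  | hG a b h1 =>
    obtain ⟨n, rfl⟩ : ∃ m, n = m + 1 := ⟨n - 1, by omega⟩
    have hf := yhFamily d (n + 2) q
    have e1 : T d (n + 2) q (n + 1) * (incl d (n + 1) q a * G d (n + 2) q n *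
        incl d (n + 1) q b) = incl d (n + 1) q a * G d (n + 2) q n *
          incl d (n + 1) q (T d (n + 1) q n * b) := by
      rw [← mul_assoc, ← mul_assoc, (T_comm_incl hd a).eq, mul_assoc _ (T _ _ _ _),
        hf.t_g_right n (by omega), map_mul, incl_T d (n + 1) q (by omega)]
      simp only [mul_assoc]
    have e2 : incl d (n + 1) q a * G d (n + 2) q n * incl d (n + 1) q b *
        T d (n + 2) q (n + 1) = incl d (n + 1) q (a * T d (n + 1) q n) * G d (n + 2) q n *
          incl d (n + 1) q b := by
      rw [mul_assoc, ← (T_comm_incl hd b).eq, ← mul_assoc, mul_assoc _ (G _ _ _ _),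
        ← hf.t_g_left n (by omega), map_mul, incl_T d (n + 1) q (by omega)]
      simp only [mul_assoc]
    rw [Nat.add_sub_cancel, e1, e2, markovTrace_G, markovTrace_G, mul_assoc]
  | hadd x y _ _ hx hy => simp only [map_add, mul_add, add_mul, hx, hy]
  | hsmul c x _ hx => simp only [map_smul, mul_smul_comm, smul_mul_assoc, hx]

/-- On a g b, symmetry turns tr(g a g b) into tr(g b g a), and a, coming from the smaller algebra,
may be moved to the front. -/
theorem markovTrace_G_comm {n : ℕ}
    (hn : ∀ m ≤ n + 1, ∀ a b : YH d m q,
      markovTrace hd hq m (a * b) = markovTrace hd hq m (b * a))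
    (x : YH d (n + 2) q) :
    markovTrace hd hq (n + 2) (G d (n + 2) q n * x) =
      markovTrace hd hq (n + 2) (x * G d (n + 2) q n) := by
  have hι := markovTrace_incl_comm hd hq (hn (n + 1) le_rfl)
  induction mem_markovSpan hd (n + 1) x using markovSpan_induction with
  | hT a s =>
    have e1 := markovTrace_G hd hq n (T d (n + 1) q n ^ s) a
    have e2 := markovTrace_G hd hq n a (T d (n + 1) q n ^ s)
    rw [← ((T_comm_incl hd a).pow_left s).eq, ← mul_assoc, G_mul_T_pow, e1,
      ((T_comm_incl hd a).pow_left s).eq, mul_assoc, T_pow_mul_G, ← mul_assoc, e2,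
      hn (n + 1) le_rfl]
  | hG a b h1 =>
    rw [Nat.add_sub_cancel, ← mul_assoc, ← mul_assoc, markovTrace_symm hd hq hn, ← hι]
    simp only [mul_assoc]
  | hadd x y _ _ hx hy => simp only [map_add, mul_add, add_mul, hx, hy]
  | hsmul c x _ hx => simp only [map_smul, mul_smul_comm, smul_mul_assoc, hx]

/-- Elements that commute with everything under the trace are closed under products, so generators
suffice. The induction is strong because the last crossing needs the trace property two levels down.
-/
theorem markovTrace_comm (n : ℕ) (a b : YH d n q) :
    markovTrace hd hq n (a * b) = markovTrace hd hq n (b * a) := by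
  induction n using Nat.strong_induction_on with
  | _ n ih =>
  cases n with
  | zero =>
    change (yhFamily_zero d q).lift hd (a * b) = (yhFamily_zero d q).lift hd (b * a)
    rw [map_mul, map_mul, mul_comm]
  | succ n =>
    have hι := markovTrace_incl_comm hd hq (ih n (by omega))
    induction a using YH_induction hd generalizing b with
    | hG i hi =>
      rcases (show i + 1 ≤ n by omega).eq_or_lt with rfl | hi
      · exact markovTrace_G_comm hd hq (fun m hm => ih m (by omega)) b
      · rw [← incl_G d n q hi, hι]
    | hT j hj =>
      rcases (show j ≤ n by omega).eq_or_lt with rfl | hj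
      · exact markovTrace_T_comm hd hq (ih j (by omega)) b
      · rw [← incl_T d n q hj, hι]
    | hc c => rw [Algebra.commutes]
    | hadd x y hx hy => rw [add_mul, mul_add, map_add, map_add, hx, hy]
    | hmul x y hx hy => rw [mul_assoc, hx, mul_assoc, hy, mul_assoc]

theorem markovTrace_isMarkovTrace : IsMarkovTrace d q (markovTrace hd hq) where
  compat := markovTrace_incl hd hq
  comm := markovTrace_comm hd hq
  one := markovTrace_one hd hq
  markov m a := by
    have h := markovTrace_G hd hq m a 1
    rwa [map_one, mul_one, mul_one, G_eq d (m + 2) q (Nat.lt_succ_self (m + 1))] at h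
  framing n a s h₁ h₂ := by
    have h := markovTrace_T hd hq n a s
    rwa [T_eq d (n + 1) q (Nat.lt_succ_self n), Nat.mod_eq_of_lt h₂, framingVar,
      dif_pos ⟨h₁, h₂⟩] at h

end existence

/-! ### Inversion -/

section inversion

variable {d : ℕ} {q : ℂ}

theorem reverse_algebraMap (d n : ℕ) (q c : ℂ) :
    reverse d n q (algebraMap ℂ _ c) = algebraMap ℂ _ c := by
  simp [reverse]

theorem reverse_one (d n : ℕ) (q : ℂ) : reverse d n q 1 = 1 := by
  simp [reverse]

theorem reverse_t_pow (d n : ℕ) (q : ℂ) (j : Fin n) (s : ℕ) :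
    reverse d n q (t d q j ^ s) = t d q j ^ s := by
  induction s with
  | zero => rw [pow_zero, reverse_one]
  | succ s ih => rw [pow_succ, reverse_mul, ih, reverse_t, ← pow_succ', ← pow_succ]

theorem reverse_incl (hd : 1 ≤ d) (n : ℕ) (a : YH d n q) :
    reverse d (n + 1) q (incl d n q a) = incl d n q (reverse d n q a) := by
  induction a using YH_induction hd with
  | hG i hi =>
    rw [incl_G d n q hi, G_eq d n q hi, reverse_g, ← G_eq d n q hi, incl_G d n q hi,
      G_eq d (n + 1) q (by omega), reverse_g]
  | hT j hj =>
    rw [incl_T d n q hj, T_eq d n q hj, reverse_t, ← T_eq d n q hj, incl_T d n q hj,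
      T_eq d (n + 1) q (by omega), reverse_t]
  | hc c => rw [AlgHom.commutes, reverse_algebraMap, reverse_algebraMap, AlgHom.commutes]
  | hadd x y hx hy => simp only [map_add, hx, hy]
  | hmul x y hx hy => rw [map_mul, reverse_mul, reverse_mul, map_mul, hx, hy]

/-- Inversion moves the last generator to the front, and the trace property moves it back to the
end. -/
theorem IsMarkovTrace.reverse (hd : 1 ≤ d) {tr : (n : ℕ) → YH d n q →ₗ[ℂ] TraceRing d}
    (h : IsMarkovTrace d q tr) :
    IsMarkovTrace d q (fun n => tr n ∘ₗ YokonumaHecke.reverse d n q) where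
  compat n a := by
    rw [LinearMap.comp_apply, LinearMap.comp_apply, reverse_incl hd, h.compat]
  comm n a b := by
    rw [LinearMap.comp_apply, LinearMap.comp_apply, reverse_mul, reverse_mul, h.comm]
  one n := by rw [LinearMap.comp_apply, reverse_one, h.one]
  markov m a := by
    rw [LinearMap.comp_apply, LinearMap.comp_apply, reverse_mul, reverse_incl hd, reverse_g,
      h.comm, h.markov]
  framing n a s h₁ h₂ := by
    rw [LinearMap.comp_apply, LinearMap.comp_apply, reverse_mul, reverse_incl hd, reverse_t_pow,
      h.comm, h.framing n _ s h₁ h₂]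

theorem reverse_ofModular (d n : ℕ) (q : ℂ) (x : ModularFramedBraidGroup d n) :
    reverse d n q (ofModular d n q x) = ofModular d n q (modularReverseHom d n x).unop := by
  simp [reverse, reverseHom, ofModular, MonoidAlgebra.lift_of, -MonoidAlgebra.of_apply]

theorem toModular_framedReverse (d n : ℕ) (α : FramedBraidGroup n) :
    toModular d n (framedReverse n α) = (modularReverseHom d n (toModular d n α)).unop := by
  have h : (MonoidHom.op (toModular d n)).comp (framedReverseHom n) =
      (modularReverseHom d n).comp (toModular d n) := by
    refine PresentedGroup.ext fun x => ?_
    simp [framedReverseHom, modularReverseHom, toModular]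
  exact congrArg MulOpposite.unop (DFunLike.congr_fun h α)

theorem ofFramedBraid_framedReverse (d n : ℕ) (q : ℂ) (α : FramedBraidGroup n) :
    ofFramedBraid d n q (framedReverse n α) = reverse d n q (ofFramedBraid d n q α) := by
  simp only [ofFramedBraid, MonoidHom.comp_apply, toModular_framedReverse, reverse_ofModular]

end inversion

end YokonumaHecke

end

theorem mainTheorem7 (d : ℕ) (hd : 1 ≤ d) (q : ℂ) (hq : q ≠ 0) :
    ∃ trd : (n : ℕ) → YokonumaHecke.YH d n q →ₗ[ℂ] YokonumaHecke.TraceRing d,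
      YokonumaHecke.IsMarkovTrace d q trd ∧
      (∀ tr' : (n : ℕ) → YokonumaHecke.YH d n q →ₗ[ℂ] YokonumaHecke.TraceRing d,
        YokonumaHecke.IsMarkovTrace d q tr' → tr' = trd) ∧
      (∀ (n : ℕ) (a : YokonumaHecke.YH d n q),
        trd n a = trd n (YokonumaHecke.reverse d n q a)) ∧
      (∀ (n : ℕ) (α : YokonumaHecke.FramedBraidGroup n),
        trd n (YokonumaHecke.ofFramedBraid d n q α) =
          trd n (YokonumaHecke.ofFramedBraid d n q (YokonumaHecke.framedReverse n α))) := by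
  have h := YokonumaHecke.markovTrace_isMarkovTrace hd hq
  have hrev (n : ℕ) (a : YokonumaHecke.YH d n q) : YokonumaHecke.markovTrace hd hq n a =
      YokonumaHecke.markovTrace hd hq n (YokonumaHecke.reverse d n q a) :=
    LinearMap.congr_fun (congrFun (h.unique hd (h.reverse hd)) n) a
  refine ⟨YokonumaHecke.markovTrace hd hq, h, fun tr' h' => h'.unique hd h, hrev, fun n α => ?_⟩
  rw [YokonumaHecke.ofFramedBraid_framedReverse]
  exact hrev n _
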